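/- For a finite graph $G$ on $n\ge 1$ vertices, order the vertices uniformly at random and build an independent set $\mathbf I(G)$ by going through the vertices in this order and adding a vertex whenever the resulting set spans no edge; let $\iota(G)=|\mathbf I(G)|/n$ (if $G$ is random, the order is independent of $G$). For a random rooted, possibly infinite, graph $(U,\rho)$ give the vertices independent labels, uniform in $[0,1]$ and independent of $U$, and let the past of $\rho$ be the set of vertices reachable from $\rho$ by paths along which the labels decrease. If the past of $\rho$ is almost surely finite, $(U,\rho)$ is said to have nonexplosive growth, and $\iota(U,\rho)$ denotes the probability that $\rho$ belongs to the greedy independent set of the subgraph induced by the past of $\rho$, its vertices being considered in increasing order of their labels. For $0<\lambda\le 1$ let $GW(\lambda)$ be the Galton--Watson tree with offspring distribution $\mathrm{Pois}(\lambda)$, and let $\widehat{GW}(\lambda)$ be the size-biased Poisson Galton--Watson tree, i.e. the two-type branching process in which the root is a spine vertex, a spine vertex has exactly one spine child and, independently, $\mathrm{Pois}(\lambda)$ tree children, and a tree vertex has $\mathrm{Pois}(\lambda)$ tree children, all offspring numbers being independent. Then both trees have nonexplosive growth, and $$\iota(\widehat{GW}(\lambda))=1-(1+\lambda)^{-1/\lambda}=1-e^{-\iota(GW(\lambda))};$$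 in particular $\iota(\widehat{GW}(1))=1/2$. Moreover, if $T_n$ is uniformly distributed among the $n^{n-2}$ labelled trees on $n$ vertices, then $\iota(T_n)\sim 1/2$ with high probability, that is, for every $\varepsilon>0$, $$\Pr\left[\,|2\,\iota(T_n)-1|\le\varepsilon\,\right]\to 1\qquad(n\to\infty).$$ The same holds for the random functional digraph on $n$ vertices with orientations ignored, that is, for the simple graph on $\{1,\dots,n\}$ whose edges are the pairs $\{i,f(i)\}$ with $f(i)\ne i$, where $f$ is a uniformly random map from $\{1,\dots,n\}$ to itself. -/

import Mathlib

open MeasureTheory ProbabilityTheory Filter Topology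
open scoped NNReal ENNReal

namespace GreedyMIS

/-- The greedy algorithm: the vertices of `l` are considered one by one in order, and a vertex is
added if the resulting set still spans no edge. -/
def greedySet {V : Type*} (G : SimpleGraph V) (l : List V) : Set V :=
  l.foldl (fun I v => I ∪ {w | w = v ∧ ∀ u ∈ I, ¬ G.Adj u v}) ∅

/-! ### Finite random graphs -/

/-- The density of the greedy independent set of a graph on `n` labelled vertices, when the vertices
are considered in the order `π 0, π 1, …, π (n - 1)`. -/
noncomputable def greedyRatio {n : ℕ} (G : SimpleGraph (Fin n)) (π : Equiv.Perm (Fin n)) : ℝ :=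
  ((greedySet G (List.ofFn π)).ncard : ℝ) / (n : ℝ)

/-- The law of the greedy independence ratio `ι(G)` of a random graph `G` with law `p`:
`G` is sampled from `p` and then, independently, a uniform random order of the vertices is
sampled. -/
noncomputable def greedyRatioLaw {n : ℕ} (p : PMF (SimpleGraph (Fin n))) : PMF ℝ :=
  p.bind fun G => (PMF.uniformOfFintype (Equiv.Perm (Fin n))).map (greedyRatio G)

/-- `X n ∼ c` with high probability, for random variables `X n` with laws `L n` and a nonzero
constant `c`: for every `ε > 0`, the probability that `|X n / c - 1| ≤ ε` tends to `1`. -/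
def AsympWhp (L : ℕ → PMF ℝ) (c : ℝ) : Prop :=
  ∀ ε : ℝ, 0 < ε → Tendsto (fun n => (L n).toMeasure {x : ℝ | |x / c - 1| ≤ ε}) atTop (𝓝 1)

theorem exists_labelled_tree (n : ℕ) [NeZero n] :
    (Set.toFinite {G : SimpleGraph (Fin n) | G.IsTree}).toFinset.Nonempty := by
  obtain ⟨T, -, hT⟩ := (SimpleGraph.connected_top (V := Fin n)).exists_isTree_le
  exact ⟨T, by simpa using hT⟩

/-- The uniform random labelled tree on `n ≥ 1` vertices. -/
noncomputable def uniformTree (n : ℕ) [NeZero n] : PMF (SimpleGraph (Fin n)) :=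
  PMF.uniformOfFinset (Set.toFinite {G : SimpleGraph (Fin n) | G.IsTree}).toFinset
    (exists_labelled_tree n)

/-- The graph underlying the functional digraph with edges `(i, f i)`: orientations (and loops and
multiplicities) are ignored. -/
def functionalGraph {n : ℕ} (f : Fin n → Fin n) : SimpleGraph (Fin n) :=
  SimpleGraph.fromRel fun i j => f i = j

/-- The random functional digraph on `n ≥ 1` vertices, with orientations ignored: the map `f` is
uniform among all maps from the vertex set to itself. -/
noncomputable def randomFunctionalGraph (n : ℕ) [NeZero n] : PMF (SimpleGraph (Fin n)) :=
  (PMF.uniformOfFintype (Fin n → Fin n)).map functionalGraph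

/-! ### Random rooted infinite graphs -/

/-- The past of `v`: all vertices reachable from `v` by a path along which the labels decrease. -/
def past {V : Type*} (G : SimpleGraph V) (σ : V → unitInterval) (v : V) : Set V :=
  {w | Relation.ReflTransGen (fun a b => G.Adj a b ∧ σ b < σ a) v w}

/-- `l` lists the elements of the (finite) set `S` in increasing order of their labels. -/
def IsArrivalOrder {V : Type*} (σ : V → unitInterval) (S : Set V) (l : List V) : Prop :=
  l.Pairwise (fun u v => σ u < σ v) ∧ ∀ v, v ∈ l ↔ v ∈ S

/-- The past of `ρ` is finite, and `ρ` belongs to the greedy independent set of the subgraph induced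
by the past of `ρ`, when the vertices are considered in increasing order of their labels. -/
def RootOccupied {V : Type*} (G : SimpleGraph V) (σ : V → unitInterval) (ρ : V) : Prop :=
  ∃ l : List V, IsArrivalOrder σ (past G σ ρ) l ∧ ρ ∈ greedySet G l

/-- The law of a random labelling: i.i.d. labels, uniform in `[0, 1]`. -/
noncomputable def labelLaw (V : Type*) : Measure (V → unitInterval) :=
  Measure.infinitePi fun _ => volume

/-- The random graph `U` (defined on the probability space `(Ω, P)`, with root `ρ`; only the
component of `ρ` matters) has nonexplosive growth: under an independent random labelling, the past
of the root is almost surely finite. -/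
def NonexplosiveGrowth {Ω V : Type*} [MeasurableSpace Ω] (P : Measure Ω) (U : Ω → SimpleGraph V)
    (ρ : V) : Prop :=
  ∀ᵐ p ∂(P.prod (labelLaw V)), (past (U p.1) p.2 ρ).Finite

/-- `ι(U, ρ)`: the probability that the root belongs to the greedy independent set of its past. -/
noncomputable def iota {Ω V : Type*} [MeasurableSpace Ω] (P : Measure Ω) (U : Ω → SimpleGraph V)
    (ρ : V) : ℝ :=
  (P.prod (labelLaw V)).real {p | RootOccupied (U p.1) p.2 ρ}

/-! ### Multitype branching processes -/

/-- Potential vertices: the root is the empty list, and `(j, i) :: v` is the `i`-th child of type `j`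
of `v`, with `i` counted from `0`. -/
abbrev Node (T : Type*) := List (T × ℕ)

/-- The type of a vertex, when the root has type `τ`. -/
def nodeType {T : Type*} (τ : T) : Node T → T
  | [] => τ
  | c :: _ => c.1

/-- The vertices that are present in the tree, when `v` has `ξ v j` children of type `j`. -/
def InTree {T : Type*} (ξ : Node T → T → ℕ) : Node T → Prop
  | [] => True
  | c :: v => InTree ξ v ∧ c.2 < ξ v c.1

/-- The family tree with offspring numbers `ξ`, as a graph (with root `[]`) on all potential
vertices; those that are not present in the tree are isolated. -/
def branchingTree {T : Type*} (ξ : Node T → T → ℕ) : SimpleGraph (Node T) :=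
  SimpleGraph.fromRel fun u v => InTree ξ v ∧ ∃ c : T × ℕ, v = c :: u

/-- The law of the offspring numbers in the simple multitype branching process with root type `τ`
and offspring distributions `μ k j` (the law of the number of children of type `j` of a vertex of
type `k`): all the offspring numbers are independent. -/
noncomputable def offspringLaw {T : Type*} (τ : T) (μ : T → T → Measure ℕ) :
    Measure (Node T → T → ℕ) :=
  Measure.infinitePi fun v => Measure.infinitePi fun j => μ (nodeType τ v) j

/-- Nonexplosive growth of a simple multitype branching process. -/
def BPNonexplosive {T : Type*} (τ : T) (μ : T → T → Measure ℕ) : Prop :=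
  NonexplosiveGrowth (offspringLaw τ μ) branchingTree []

/-- The value of `ι` at a simple multitype branching process. -/
noncomputable def bpIota {T : Type*} (τ : T) (μ : T → T → Measure ℕ) : ℝ :=
  iota (offspringLaw τ μ) branchingTree []

/-- Offspring distribution of the Poisson Galton–Watson tree, which has a single type. -/
noncomputable def gwOffspring (lam : ℝ≥0) : Unit → Unit → Measure ℕ :=
  fun _ _ => poissonMeasure lam

/-- The types of the size-biased Poisson Galton–Watson tree. -/
inductive SBType
  | spine
  | tree

/-- Offspring distributions of the size-biased Poisson Galton–Watson tree: a spine vertex has one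
spine child and `Pois(lam)` tree children, and a tree vertex has `Pois(lam)` tree children. -/
noncomputable def sbgwOffspring (lam : ℝ≥0) : SBType → SBType → Measure ℕ
  | .spine, .spine => Measure.dirac 1
  | .tree, .spine => Measure.dirac 0
  | _, .tree => poissonMeasure lam

end GreedyMIS

/-!
In a branching process the root is occupied exactly when no child with a smaller label is occupied
in its own subtree, and these subtrees are independent. Conditioning on the label of the root shows
that the probability `F t k` that a root of type `k` is occupied and has a label below `t` satisfies
`F' t k = ∏ j, 𝔼[(1 - F t j) ^ m k j]`, where `m k j` is the number of children of type `j`. Finite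
means make the right-hand side Lipschitz, so the solution with `F 0 = 0` is unique; for Poisson
offspring it is `log (1 + lam * t) / lam`. Likewise, the past of the root is infinite exactly when
that of some child with a smaller label is, so the corresponding probability satisfies
`G' t k = 1 - ∏ j, 𝔼[(1 - G t j) ^ m k j]` with `G 0 = 0`, and uniqueness gives `G = 0`.

For the graph of a uniform map `f` on `n` points, reveal `f v` only when `v` is considered. If `S`
is the set of points selected so far and `W` the set of later points that are not hit by `S`, then
`|W| + 2 * |S| - n` starts at `0` and ends at `2 * |S| - n`. It moves only when `v` is not hit,
and then by at most `1` and with mean `1 / n` minus an `n`-th of its value, so its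
exponential moments grow no faster than those of a simple random walk, and `|S| / n` is close to
`1 / 2` up to exponentially small probability. This survives the passage to uniform trees: adding
edges to forests one at a time shows that there are at least `n ^ (n - 2)` trees on `n` vertices,
and each is the graph of a map, so a tree deviates with probability at most `n ^ 2` times that for a
map.
-/

namespace GreedyMIS

/-! ### The greedy set of a graph and the past of a vertex -/

section Greedy

variable {V W : Type*} {G : SimpleGraph V}

theorem greedySet_nil : greedySet G [] = ∅ := rfl

theorem greedySet_concat (G : SimpleGraph V) (l : List V) (v : V) :
    greedySet G (l ++ [v]) =
      greedySet G l ∪ {w | w = v ∧ ∀ u ∈ greedySet G l, ¬ G.Adj u v} := by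
  simp only [greedySet, List.foldl_append, List.foldl_cons, List.foldl_nil]

theorem mem_of_mem_greedySet {l : List V} {v : V} (hv : v ∈ greedySet G l) : v ∈ l := by
  induction l using List.reverseRecOn with
  | nil => exact hv.elim
  | append_singleton l w ih =>
    rw [greedySet_concat] at hv
    rcases hv with hv | ⟨rfl, -⟩
    · exact List.mem_append_left _ (ih hv)
    · simp

theorem greedySet_map (G : SimpleGraph W) (e : V → W) (l : List V) :
    greedySet G (l.map e) = e '' greedySet (G.comap e) l := by
  induction l using List.reverseRecOn with
  | nil => simp only [List.map_nil, greedySet_nil, Set.image_empty]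
  | append_singleton l v ih =>
    rw [List.map_append, List.map_singleton, greedySet_concat, greedySet_concat, ih,
      Set.image_union]
    congr 1
    ext w
    constructor
    · rintro ⟨rfl, h⟩
      exact ⟨v, ⟨rfl, fun u hu => h _ ⟨u, hu, rfl⟩⟩, rfl⟩
    · rintro ⟨_, ⟨rfl, h⟩, rfl⟩
      exact ⟨rfl, by rintro _ ⟨u, hu, rfl⟩; exact h u hu⟩

theorem greedySet_filter {p : V → Prop} [DecidablePred p] {l : List V}
    (hl : l.Pairwise fun u v => G.Adj u v → p v → p u) :
    greedySet G (l.filter p) = {v ∈ greedySet G l | p v} := by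
  induction l using List.reverseRecOn with
  | nil => simp only [List.filter_nil, greedySet_nil, Set.mem_empty_iff_false, false_and]; rfl
  | append_singleton l v ih =>
    obtain ⟨hl', -, hlast⟩ := List.pairwise_append.1 hl
    have hclosed : ∀ u ∈ greedySet G l, G.Adj u v → p v → p u := fun u hu =>
      hlast u (mem_of_mem_greedySet hu) v (List.mem_singleton_self v)
    ext w
    by_cases hv : p v
    · simp only [List.filter_append, List.filter_singleton, hv, decide_true, cond_true,
        greedySet_concat, ih hl', Set.mem_union, Set.mem_ofPred_eq]
      grind
    · simp only [List.filter_append, List.filter_singleton, hv, decide_false, cond_false,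
        List.append_nil, greedySet_concat, ih hl', Set.mem_union, Set.mem_ofPred_eq]
      grind

end Greedy

section Past

variable {V W : Type*} {G : SimpleGraph V} {σ : V → unitInterval} {u v : V}

theorem mem_past_self (G : SimpleGraph V) (σ : V → unitInterval) (v : V) : v ∈ past G σ v :=
  Relation.ReflTransGen.refl

theorem past_subset_of_mem (h : u ∈ past G σ v) : past G σ u ⊆ past G σ v := fun _ hw =>
  Relation.ReflTransGen.trans h hw

theorem mem_past_of_adj (hadj : G.Adj u v) (hσ : σ u < σ v) : u ∈ past G σ v :=
  Relation.ReflTransGen.single ⟨hadj.symm, hσ⟩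

theorem past_eq_insert (G : SimpleGraph V) (σ : V → unitInterval) (v : V) :
    past G σ v = insert v (⋃ u ∈ {u | G.Adj v u ∧ σ u < σ v}, past G σ u) := by
  ext w
  simp only [past, Set.mem_ofPred_eq, Set.mem_insert_iff, Set.mem_iUnion, exists_prop,
    Relation.ReflTransGen.cases_head_iff (a := v), eq_comm (a := v)]

theorem label_lt_of_mem_past (h : u ∈ past G σ v) (hne : u ≠ v) : σ u < σ v := by
  induction h with
  | refl => exact absurd rfl hne
  | @tail a b _ hab ih =>
    rcases eq_or_ne a v with rfl | ha
    · exact hab.2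
    · exact hab.2.trans (ih ha)

theorem finite_past_iff (hfin : {u | G.Adj v u ∧ σ u < σ v}.Finite) :
    (past G σ v).Finite ↔ ∀ u, G.Adj v u → σ u < σ v → (past G σ u).Finite := by
  rw [past_eq_insert, Set.finite_insert]
  exact ⟨fun h u hadj hlt => h.subset (Set.subset_biUnion_of_mem (u := past G σ) ⟨hadj, hlt⟩),
    fun h => hfin.biUnion fun u hu => h u hu.1 hu.2⟩

theorem past_map {G : SimpleGraph W} {σ : W → unitInterval} (e : V → W)
    (hclosed : ∀ v w, G.Adj (e v) w → σ w < σ (e v) → w ∈ Set.range e) (v : V) :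
    past G σ (e v) = e '' past (G.comap e) (σ ∘ e) v := by
  ext w
  constructor
  · intro h
    induction h with
    | refl => exact ⟨v, mem_past_self _ _ v, rfl⟩
    | tail _ hab ih =>
      obtain ⟨a, ha, rfl⟩ := ih
      obtain ⟨b, rfl⟩ := hclosed a _ hab.1 hab.2
      exact ⟨b, Relation.ReflTransGen.tail ha hab, rfl⟩
  · rintro ⟨w, hw, rfl⟩
    exact Relation.ReflTransGen.lift e (fun _ _ => id) _ _ hw

end Past

section ArrivalOrder

variable {V W : Type*} {G : SimpleGraph V} {σ : V → unitInterval} {S : Set V} {l l' : List V}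
  {u v : V}

theorem IsArrivalOrder.eq (h : IsArrivalOrder σ S l) (h' : IsArrivalOrder σ S l') : l = l' := by
  have : Std.Irrefl fun u v : V => σ u < σ v := ⟨fun u => lt_irrefl (σ u)⟩
  have : Std.Antisymm fun u v : V => σ u < σ v := ⟨fun u v huv hvu => absurd huv hvu.asymm⟩
  exact h.1.eq_of_mem_iff h'.1 fun v => (h.2 v).trans (h'.2 v).symm

theorem exists_isArrivalOrder (hσ : σ.Injective) (hS : S.Finite) :
    ∃ l, IsArrivalOrder σ S l := by
  let := LinearOrder.lift' σ hσ
  exact ⟨hS.toFinset.sort, hS.toFinset.sortedLT_sort.pairwise, fun v => by simp⟩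

theorem isArrivalOrder_map_iff {σ : W → unitInterval} {e : V → W} (he : e.Injective) :
    IsArrivalOrder σ (e '' S) (l.map e) ↔ IsArrivalOrder (σ ∘ e) S l := by
  simp only [IsArrivalOrder, List.pairwise_map, Function.comp_apply]
  refine and_congr_right fun _ => ⟨fun h v => ?_, fun h w => ?_⟩
  · simpa only [he.mem_set_image, List.mem_map_of_injective he] using h (e v)
  · simp only [List.mem_map, Set.mem_image, h]

theorem IsArrivalOrder.rootOccupied_iff (hl : IsArrivalOrder σ (past G σ v) l) :
    RootOccupied G σ v ↔ v ∈ greedySet G l :=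
  ⟨fun ⟨_, hl', hv⟩ => hl'.eq hl ▸ hv, fun hv => ⟨l, hl, hv⟩⟩

theorem IsArrivalOrder.rootOccupied_iff_of_mem (hl : IsArrivalOrder σ (past G σ v) l)
    (hu : u ∈ past G σ v) : RootOccupied G σ u ↔ u ∈ greedySet G l := by
  classical
  have hfilter : IsArrivalOrder σ (past G σ u) (l.filter (· ∈ past G σ u)) := by
    refine ⟨hl.1.filter _, fun w => ?_⟩
    simp only [List.mem_filter, decide_eq_true_eq, hl.2, and_iff_right_iff_imp]
    exact fun hw => past_subset_of_mem hu hw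
  have hclosed : l.Pairwise fun a b => G.Adj a b → b ∈ past G σ u → a ∈ past G σ u :=
    hl.1.imp fun hab hadj hb => past_subset_of_mem hb (mem_past_of_adj hadj hab)
  rw [hfilter.rootOccupied_iff, greedySet_filter hclosed]
  exact and_iff_left (mem_past_self G σ u)

theorem rootOccupied_iff_forall_not (hσ : σ.Injective) (hfin : (past G σ v).Finite) :
    RootOccupied G σ v ↔ ∀ u, G.Adj u v → σ u < σ v → ¬ RootOccupied G σ u := by
  obtain ⟨l, hl⟩ := exists_isArrivalOrder hσ (hfin.sdiff (t := {v}))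
  have hmem : ∀ {u}, u ∈ l → u ∈ past G σ v ∧ u ≠ v := fun hu => (hl.2 _).1 hu
  have hlast : IsArrivalOrder σ (past G σ v) (l ++ [v]) := by
    refine ⟨List.pairwise_append.2 ⟨hl.1, List.pairwise_singleton _ v, fun u hu w hw => ?_⟩,
      fun w => ?_⟩
    · rw [List.mem_singleton.1 hw]
      exact label_lt_of_mem_past (hmem hu).1 (hmem hu).2
    · rw [List.mem_append, hl.2, List.mem_singleton, ← Set.mem_insert_iff.trans or_comm,
        Set.insert_sdiff_singleton, Set.insert_eq_of_mem (mem_past_self G σ v)]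
  have hgreedy : ∀ u, u ≠ v → (u ∈ greedySet G (l ++ [v]) ↔ u ∈ greedySet G l) := by
    intro u hu
    simp only [greedySet_concat, Set.mem_union, Set.mem_ofPred_eq, hu, false_and, or_false]
  have hv : v ∉ greedySet G l := fun h => (hmem (mem_of_mem_greedySet h)).2 rfl
  rw [hlast.rootOccupied_iff, greedySet_concat, Set.mem_union, or_iff_right hv]
  constructor
  · intro h u hadj hlt hocc
    rw [hlast.rootOccupied_iff_of_mem (mem_past_of_adj hadj hlt), hgreedy u hadj.ne] at hocc
    exact h.2 u hocc hadj
  · refine fun h => ⟨rfl, fun u hu hadj => ?_⟩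
    obtain ⟨hpast, hne⟩ := hmem (mem_of_mem_greedySet hu)
    refine h u hadj (label_lt_of_mem_past hpast hne) ?_
    rwa [hlast.rootOccupied_iff_of_mem hpast, hgreedy u hne]

theorem rootOccupied_map_iff {G : SimpleGraph W} {σ : W → unitInterval} {e : V → W}
    (he : e.Injective) (hclosed : ∀ v w, G.Adj (e v) w → σ w < σ (e v) → w ∈ Set.range e) (v : V) :
    RootOccupied G σ (e v) ↔ RootOccupied (G.comap e) (σ ∘ e) v := by
  rw [RootOccupied, RootOccupied, past_map e hclosed]
  constructor
  · rintro ⟨l, hl, hv⟩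
    obtain ⟨l, rfl⟩ : l ∈ Set.range (List.map e) := by
      rw [Set.range_list_map]
      exact fun w hw => Set.image_subset_range _ _ ((hl.2 w).1 hw)
    rw [greedySet_map G e, he.mem_set_image] at hv
    exact ⟨l, (isArrivalOrder_map_iff he).1 hl, hv⟩
  · rintro ⟨l, hl, hv⟩
    refine ⟨l.map e, (isArrivalOrder_map_iff he).2 hl, ?_⟩
    rwa [greedySet_map G e, he.mem_set_image]

end ArrivalOrder

section Measurability

variable {Ω V : Type*} [MeasurableSpace Ω] [Countable V]

theorem measurable_reflTransGen {r : Ω → V → V → Prop} (hr : ∀ u v, Measurable fun ω => r ω u v)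
    (u v : V) : Measurable fun ω => Relation.ReflTransGen (r ω) u v := by
  have hchain : ∀ l : List V, Measurable fun ω => List.IsChain (r ω) l := fun l => by
    simp only [List.isChain_iff_getElem]
    exact .forall fun i => .forall fun hi => hr _ _
  have hiff : ∀ ω, Relation.ReflTransGen (r ω) u v ↔
      ∃ l : List V, List.IsChain (r ω) (u :: l) ∧ (u :: l).getLast (by simp) = v := fun ω =>
    ⟨List.exists_isChain_cons_of_relationReflTransGen,
      fun ⟨l, hl, hv⟩ => List.relationReflTransGen_of_exists_isChain_cons l hl hv⟩
  simp only [hiff]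
  exact .exists fun l => (hchain _).and measurable_const

variable {G : Ω → SimpleGraph V} {σ : Ω → V → unitInterval}

theorem measurable_past (hG : ∀ u v, Measurable fun ω => (G ω).Adj u v) (hσ : Measurable σ)
    (v : V) : Measurable fun ω => past (G ω) (σ ω) v :=
  measurable_set_iff.2 fun w => measurable_reflTransGen (fun a b => (hG a b).and
    (measurableSet_lt (measurable_pi_iff.1 hσ b) (measurable_pi_iff.1 hσ a)).mem) v w

theorem measurable_greedySet (hG : ∀ u v, Measurable fun ω => (G ω).Adj u v) (l : List V) :
    Measurable fun ω => greedySet (G ω) l := by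
  induction l using List.reverseRecOn with
  | nil => exact measurable_const
  | append_singleton l v ih =>
    simp only [greedySet_concat]
    refine measurable_set_iff.2 fun w => (measurable_set_iff.1 ih w).or ?_
    exact measurable_const.and (.forall fun u => (measurable_set_iff.1 ih u).imp (hG u v).not)

theorem measurable_rootOccupied (hG : ∀ u v, Measurable fun ω => (G ω).Adj u v)
    (hσ : Measurable σ) (v : V) : Measurable fun ω => RootOccupied (G ω) (σ ω) v := by
  simp only [RootOccupied, IsArrivalOrder, List.pairwise_iff_getElem]
  refine .exists fun l => .and (.and ?_ (.forall fun w => ?_))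
    (measurable_set_iff.1 (measurable_greedySet hG l) v)
  · exact .forall fun i => .forall fun j => .forall fun _ => .forall fun _ => .forall fun _ =>
      (measurableSet_lt (measurable_pi_iff.1 hσ _) (measurable_pi_iff.1 hσ _)).mem
  · exact measurable_const.iff (measurable_set_iff.1 (measurable_past hG hσ v) w)

end Measurability

/-! ### Subtrees of the family tree -/

section Subtree

variable {T : Type*}

/-- The restriction of a family `ω` indexed by the potential vertices to the descendants of the
child `c` of the root, which are again indexed by all potential vertices. -/
def subtree {α : Type*} (c : T × ℕ) (ω : Node T → α) : Node T → α := fun u => ω (u ++ [c])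

theorem append_singleton_injective (c : T × ℕ) :
    Function.Injective fun u : Node T => u ++ [c] :=
  List.append_left_injective [c]

variable {ξ : Node T → T → ℕ} {σ : Node T → unitInterval} {c : T × ℕ}

theorem inTree_append_singleton (ξ : Node T → T → ℕ) (c : T × ℕ) (u : Node T) :
    InTree ξ (u ++ [c]) ↔ c.2 < ξ [] c.1 ∧ InTree (subtree c ξ) u := by
  induction u with
  | nil => simp only [List.nil_append, InTree, true_and, and_true]
  | cons d u ih => simp only [List.cons_append, InTree, ih, and_assoc, subtree]

theorem branchingTree_adj {u v : Node T} :
    (branchingTree ξ).Adj u v ↔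
      (InTree ξ v ∧ ∃ c, v = c :: u) ∨ InTree ξ u ∧ ∃ c, u = c :: v := by
  rw [branchingTree, SimpleGraph.fromRel_adj, and_iff_right_iff_imp]
  rintro (⟨-, c, rfl⟩ | ⟨-, c, rfl⟩) <;> simp

theorem branchingTree_adj_nil_iff {v : Node T} :
    (branchingTree ξ).Adj [] v ↔ ∃ c : T × ℕ, c.2 < ξ [] c.1 ∧ [c] = v := by
  rw [branchingTree_adj]
  constructor
  · rintro (⟨hv, c, rfl⟩ | ⟨-, c, h⟩)
    · exact ⟨c, hv.2, rfl⟩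
    · exact absurd h (by simp)
  · rintro ⟨c, hc, rfl⟩
    exact Or.inl ⟨⟨trivial, hc⟩, c, rfl⟩

theorem branchingTree_comap_append_singleton (hc : c.2 < ξ [] c.1) :
    (branchingTree ξ).comap (· ++ [c]) = branchingTree (subtree c ξ) := by
  ext u v
  simp only [SimpleGraph.comap_adj, branchingTree_adj, inTree_append_singleton, hc, true_and,
    ← List.cons_append, (append_singleton_injective c).eq_iff]

theorem mem_range_append_singleton_of_adj (hlt : σ [c] < σ []) (v w : Node T)
    (hadj : (branchingTree ξ).Adj (v ++ [c]) w) (hw : σ w < σ (v ++ [c])) :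
    w ∈ Set.range fun u : Node T => u ++ [c] := by
  rcases branchingTree_adj.1 hadj with ⟨-, d, rfl⟩ | ⟨-, d, h⟩
  · exact ⟨d :: v, rfl⟩
  · cases v with
    | nil =>
      obtain ⟨-, rfl⟩ := List.cons.inj h
      exact absurd hw hlt.not_gt
    | cons e v => exact ⟨v, (List.cons.inj h).2⟩

theorem past_subtree (hc : c.2 < ξ [] c.1) (hlt : σ [c] < σ []) :
    past (branchingTree ξ) σ [c] =
      (· ++ [c]) '' past (branchingTree (subtree c ξ)) (subtree c σ) [] := by
  rw [← branchingTree_comap_append_singleton hc]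
  exact past_map _ (mem_range_append_singleton_of_adj hlt) []

theorem rootOccupied_subtree_iff (hc : c.2 < ξ [] c.1) (hlt : σ [c] < σ []) :
    RootOccupied (branchingTree ξ) σ [c] ↔
      RootOccupied (branchingTree (subtree c ξ)) (subtree c σ) [] := by
  rw [← branchingTree_comap_append_singleton hc]
  exact rootOccupied_map_iff (append_singleton_injective c)
    (mem_range_append_singleton_of_adj hlt) []

theorem finite_children_root [Finite T] (ξ : Node T → T → ℕ) :
    {c : T × ℕ | c.2 < ξ [] c.1}.Finite := by
  refine (Set.finite_iUnion fun j => (Set.finite_Iio (ξ [] j)).image (Prod.mk j)).subset ?_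
  exact fun c hc => Set.mem_iUnion.2 ⟨c.1, c.2, hc, rfl⟩

theorem finite_past_root_iff [Finite T] :
    (past (branchingTree ξ) σ []).Finite ↔ ∀ c : T × ℕ, c.2 < ξ [] c.1 → σ [c] < σ [] →
      (past (branchingTree (subtree c ξ)) (subtree c σ) []).Finite := by
  have hfin : {u | (branchingTree ξ).Adj [] u ∧ σ u < σ []}.Finite :=
    ((finite_children_root ξ).image fun c => [c]).subset fun u hu =>
      branchingTree_adj_nil_iff.1 hu.1
  rw [finite_past_iff hfin]
  simp only [branchingTree_adj_nil_iff, forall_exists_index, and_imp, forall_apply_eq_imp_iff₂]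
  refine forall₃_congr fun c hc hlt => ?_
  rw [past_subtree hc hlt, Set.finite_image_iff (append_singleton_injective c).injOn]

theorem rootOccupied_root_iff (hσ : σ.Injective) (hfin : (past (branchingTree ξ) σ []).Finite) :
    RootOccupied (branchingTree ξ) σ [] ↔ ∀ c : T × ℕ, c.2 < ξ [] c.1 → σ [c] < σ [] →
      ¬ RootOccupied (branchingTree (subtree c ξ)) (subtree c σ) [] := by
  rw [rootOccupied_iff_forall_not hσ hfin]
  simp only [SimpleGraph.adj_comm _ _ ([] : Node T), branchingTree_adj_nil_iff,
    forall_exists_index, and_imp, forall_apply_eq_imp_iff₂]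
  exact forall₃_congr fun c hc hlt => not_congr (rootOccupied_subtree_iff hc hlt)

theorem measurable_branchingTree_adj {Ω : Type*} [MeasurableSpace Ω]
    [Countable T] {ξ : Ω → Node T → T → ℕ} (hξ : Measurable ξ) (u v : Node T) :
    Measurable fun ω => (branchingTree (ξ ω)).Adj u v := by
  have hInTree : ∀ v, Measurable fun ω => InTree (ξ ω) v := fun v => by
    induction v with
    | nil => exact measurable_const
    | cons c v ih =>
      have hcount : Measurable fun ω => ξ ω v c.1 := by fun_prop
      exact ih.and (measurableSet_lt measurable_const hcount).mem
  simp only [branchingTree_adj]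
  exact ((hInTree v).and measurable_const).or ((hInTree u).and measurable_const)

end Subtree

section Config

variable {T : Type*}

/-- The offspring numbers and the labels of all potential vertices. -/
abbrev Config (T : Type*) := Node T → (T → ℕ) × unitInterval

/-- The configurations in which the past of the root is infinite. -/
def infinitePast (T : Type*) : Set (Config T) :=
  {ω | ¬ (past (branchingTree fun v => (ω v).1) (fun v => (ω v).2) []).Finite}

/-- The configurations in which the root is occupied. -/
def occupied (T : Type*) : Set (Config T) :=
  {ω | RootOccupied (branchingTree fun v => (ω v).1) (fun v => (ω v).2) []}

/-- The configurations in which no child of the root that is present and has a smaller label than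
the root carries a subtree in `A`. -/
def rootFree (A : Set (Config T)) : Set (Config T) :=
  {ω | ∀ c : T × ℕ, c.2 < (ω []).1 c.1 → (ω [c]).2 < (ω []).2 → subtree c ω ∉ A}

theorem rootFree_empty : rootFree (∅ : Set (Config T)) = Set.univ :=
  Set.eq_univ_of_forall fun _ _ _ _ => id

theorem infinitePast_eq_compl_rootFree [Finite T] :
    infinitePast T = (rootFree (infinitePast T))ᶜ := by
  ext ω
  rw [infinitePast, Set.mem_ofPred_eq, finite_past_root_iff]
  simp only [rootFree, Set.mem_compl_iff, Set.mem_ofPred_eq, not_not]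
  rfl

theorem mem_occupied_iff_mem_rootFree {ω : Config T}
    (hinj : Function.Injective fun v => (ω v).2) (hω : ω ∉ infinitePast T) :
    ω ∈ occupied T ↔ ω ∈ rootFree (occupied T) :=
  rootOccupied_root_iff hinj (not_not.1 hω)

variable [Countable T]

theorem measurableSet_infinitePast : MeasurableSet (infinitePast T) := by
  have hadj := measurable_branchingTree_adj (ξ := fun (ω : Config T) v => (ω v).1) (by fun_prop)
  exact (MeasurableSet.setOfPred_finite.preimage (measurable_past hadj (by fun_prop) [])).compl

theorem measurableSet_occupied : MeasurableSet (occupied T) := by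
  have hadj := measurable_branchingTree_adj (ξ := fun (ω : Config T) v => (ω v).1) (by fun_prop)
  exact measurableSet_setOfPred.2 (measurable_rootOccupied hadj (by fun_prop) [])

theorem measurableSet_rootFree {A : Set (Config T)} (hA : MeasurableSet A) :
    MeasurableSet (rootFree A) := by
  have hsubtree : ∀ c : T × ℕ, Measurable (subtree c : Config T → Config T) := fun c =>
    measurable_pi_lambda _ fun v => measurable_pi_apply _
  have hcount : ∀ c : T × ℕ, Measurable fun ω : Config T => (ω []).1 c.1 := fun c => by fun_prop
  have hlabel : ∀ v : Node T, Measurable fun ω : Config T => (ω v).2 := fun v => by fun_prop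
  exact measurableSet_setOfPred.2 <| .forall fun c =>
    (measurableSet_lt measurable_const (hcount c)).mem.imp <|
      (measurableSet_lt (hlabel [c]) (hlabel [])).mem.imp (hsubtree c hA).compl.mem

end Config

/-! ### Infinite product measures -/

section InfinitePi

variable {ι κ X Y : Type*} [MeasurableSpace X] [MeasurableSpace Y]

theorem prod_infinitePi_map_zip (μ : ι → Measure X) (ν : ι → Measure Y)
    [∀ i, IsProbabilityMeasure (μ i)] [∀ i, IsProbabilityMeasure (ν i)] :
    ((Measure.infinitePi μ).prod (Measure.infinitePi ν)).map (fun p i => (p.1 i, p.2 i)) =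
      Measure.infinitePi fun i => (μ i).prod (ν i) := by
  refine ((Measure.isProjectiveLimit_infinitePi fun i => (μ i).prod (ν i)).unique ?_).symm
  intro s
  have h := (measurePreserving_arrowProdEquivProdArrow X Y s (fun i => μ i) (fun i => ν i)).symm
  rw [Measure.map_map (by fun_prop) (by fun_prop)]
  beta_reduce
  rw [← h.map_eq, ← Measure.infinitePi_map_restrict, ← Measure.infinitePi_map_restrict,
    Measure.map_prod_map _ _ (by fun_prop) (by fun_prop),
    Measure.map_map (by fun_prop) (by fun_prop)]
  rfl

variable (P : ι → Measure X) [∀ i, IsProbabilityMeasure (P i)]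

theorem indepFun_eval_infinitePi_comp {i : ι} {f : κ → ι} (hi : i ∉ Set.range f) :
    IndepFun (fun ω : ι → X => ω i) (fun ω k => ω (f k)) (Measure.infinitePi P) := by
  have hindep : iIndepFun (fun (j : ι) (ω : ι → X) => ω j) (Measure.infinitePi P) :=
    iIndepFun_infinitePi (X := fun _ => id) fun _ => measurable_id
  have hdisj : Disjoint {i} (Set.range f) := Set.disjoint_singleton_left.2 hi
  have hsup := indep_iSup_of_disjoint (fun j => (measurable_pi_apply j).comap_le)
    hindep.iIndep hdisj
  refine (IndepFun_iff_Indep _ _ _).2 (indep_of_indep_of_le_right (indep_of_indep_of_le_left hsup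
    (le_iSup₂_of_le i rfl le_rfl)) ?_)
  rw [MeasurableSpace.pi, MeasurableSpace.comap_iSup]
  refine iSup_le fun k => ?_
  rw [MeasurableSpace.comap_comp]
  exact le_iSup₂_of_le (f k) ⟨k, rfl⟩ le_rfl

theorem ae_injective_infinitePi [Countable ι] [MeasurableEq X] [∀ i, NullSingletonClass (P i)] :
    ∀ᵐ ω ∂Measure.infinitePi P, Function.Injective ω := by
  have hne : ∀ i j, i ≠ j → ∀ᵐ ω ∂Measure.infinitePi P, ω i ≠ ω j := by
    intro i j hij
    have hdiag : ∀ᵐ p ∂(P i).prod (P j), p.1 ≠ p.2 := by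
      have hmeas : MeasurableSet {p : X × X | p.1 ≠ p.2} := measurableSet_diagonal.compl
      rw [Measure.ae_prod_iff_ae_ae hmeas]
      exact Eventually.of_forall fun x => (Measure.ae_ne (P j) x).mono fun _ h => h.symm
    rw [← Measure.infinitePi_map_eval_prod hij] at hdiag
    exact ae_of_ae_map (f := fun ω : ι → X => (ω i, ω j)) (by fun_prop) hdiag
  have hall : ∀ᵐ ω ∂Measure.infinitePi P, ∀ i j, i ≠ j → ω i ≠ ω j := by
    simpa only [ae_all_iff] using hne
  filter_upwards [hall] with ω hω i j hij
  exact not_imp_not.1 (hω i j) hij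

end InfinitePi

section Subtree

variable {T X : Type*} [MeasurableSpace X] (P : Node T → Measure X)
  [∀ v, IsProbabilityMeasure (P v)]

theorem infinitePi_map_subtree :
    (Measure.infinitePi P).map (fun ω => (ω [], fun c : T × ℕ => subtree c ω)) =
      (P []).prod (Measure.infinitePi fun c => Measure.infinitePi fun u => P (u ++ [c])) := by
  let f : (T × ℕ) × Node T → Node T := fun q => q.2 ++ [q.1]
  have hinj : f.Injective := by
    rintro ⟨c, u⟩ ⟨d, v⟩ h
    obtain ⟨huv, hcd⟩ := List.append_inj' h rfl
    exact Prod.ext (List.singleton_inj.1 hcd) huv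
  have hroot : [] ∉ Set.range f := by
    rintro ⟨q, hq⟩
    exact List.append_ne_nil_of_right_ne_nil _ (List.cons_ne_nil _ _) hq
  have hindep := (indepFun_eval_infinitePi_comp P hroot).map_prod_eq_prod_map_map
    (Measurable.aemeasurable (by fun_prop)) (Measurable.aemeasurable (by fun_prop))
  rw [Measure.infinitePi_map_eval, Measure.map_infinitePi_infinitePi_of_inj hinj] at hindep
  have hcurry := Measure.infinitePi_map_curry fun (c : T × ℕ) (u : Node T) => P (u ++ [c])
  calc _ = ((Measure.infinitePi P).map fun ω => (ω [], fun q => ω (f q))).map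
        (Prod.map id (MeasurableEquiv.curry (T × ℕ) (Node T) X)) := by
        rw [Measure.map_map (by fun_prop) (Measurable.prodMk (by fun_prop) (by fun_prop))]
        rfl
    _ = _ := by
        rw [hindep, ← Measure.map_prod_map _ _ measurable_id (by fun_prop), Measure.map_id, hcurry]

end Subtree

section Law

variable {T : Type*} (τ : T) (μ : T → T → Measure ℕ)

/-- The law of the offspring numbers and the label of a vertex of type `τ`. -/
noncomputable def vertexLaw : Measure ((T → ℕ) × unitInterval) :=
  (Measure.infinitePi fun j => μ τ j).prod volume

/-- The law of the offspring numbers and the labels of all potential vertices, when the root has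
type `τ`. -/
noncomputable def configLaw : Measure (Config T) :=
  Measure.infinitePi fun v => vertexLaw (nodeType τ v) μ

variable [∀ k j, IsProbabilityMeasure (μ k j)]

instance : IsProbabilityMeasure (vertexLaw τ μ) := by
  unfold vertexLaw; infer_instance

instance : IsProbabilityMeasure (configLaw τ μ) := by
  unfold configLaw; infer_instance

instance : IsProbabilityMeasure (offspringLaw τ μ) := by
  unfold offspringLaw; infer_instance

instance (V : Type*) : IsProbabilityMeasure (labelLaw V) := by
  unfold labelLaw; infer_instance

theorem offspringLaw_prod_labelLaw_map :
    ((offspringLaw τ μ).prod (labelLaw (Node T))).map (fun p v => (p.1 v, p.2 v)) =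
      configLaw τ μ :=
  prod_infinitePi_map_zip (fun v => Measure.infinitePi fun j => μ (nodeType τ v) j)
    fun _ => volume

theorem configLaw_map_labels :
    (configLaw τ μ).map (fun ω v => (ω v).2) = labelLaw (Node T) := by
  rw [← offspringLaw_prod_labelLaw_map, Measure.map_map (by fun_prop) (by fun_prop)]
  exact measurePreserving_snd.map_eq

theorem ae_injective_labels [Countable T] :
    ∀ᵐ ω ∂configLaw τ μ, Function.Injective fun v => (ω v).2 := by
  have hinj : ∀ᵐ σ ∂labelLaw (Node T), Function.Injective σ := ae_injective_infinitePi _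
  rw [← configLaw_map_labels τ μ] at hinj
  exact ae_of_ae_map (f := fun (ω : Config T) v => (ω v).2)
    (Measurable.aemeasurable (by fun_prop)) hinj

theorem nodeType_append_singleton (c : T × ℕ) (u : Node T) :
    nodeType τ (u ++ [c]) = nodeType c.1 u := by
  cases u <;> rfl

theorem configLaw_map_subtree :
    (configLaw τ μ).map (fun ω => (ω [], fun c : T × ℕ => subtree c ω)) =
      (vertexLaw τ μ).prod (Measure.infinitePi fun c => configLaw c.1 μ) := by
  simp only [configLaw, infinitePi_map_subtree, nodeType_append_singleton]
  rfl

theorem bpNonexplosive_iff [Countable T] :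
    BPNonexplosive τ μ ↔ (configLaw τ μ).real (infinitePast T) = 0 := by
  rw [measureReal_eq_zero_iff, ← offspringLaw_prod_labelLaw_map,
    Measure.map_apply (by fun_prop) measurableSet_infinitePast]
  rfl

theorem bpIota_eq [Countable T] : bpIota τ μ = (configLaw τ μ).real (occupied T) := by
  rw [← offspringLaw_prod_labelLaw_map,
    map_measureReal_apply (by fun_prop) measurableSet_occupied]
  rfl

end Law

/-! ### The integral recursion for the label of the root -/

theorem measureReal_prod_apply {X Y : Type*} [MeasurableSpace X] [MeasurableSpace Y]
    {μ : Measure X} {ν : Measure Y} [IsFiniteMeasure ν] {s : Set (X × Y)} (hs : MeasurableSet s) :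
    (μ.prod ν).real s = ∫ x, ν.real (Prod.mk x ⁻¹' s) ∂μ := by
  rw [Measure.real, Measure.prod_apply hs]
  exact (integral_toReal (measurable_measure_prodMk_left hs).aemeasurable
    (Eventually.of_forall fun x => measure_lt_top ν _)).symm

theorem integral_indicator_Iio_unitInterval {E : Type*} [NormedAddCommGroup E] [NormedSpace ℝ E]
    (f : ℝ → E) {t : ℝ} (ht : t ∈ Set.Icc (0 : ℝ) 1) :
    ∫ y : unitInterval, (Set.Iio t).indicator f y = ∫ s in (0 : ℝ)..t, f s := by
  have hset : Set.Iio t ∩ unitInterval = Set.Ico 0 t := by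
    ext s
    simp only [Set.mem_inter_iff, Set.mem_Iio, Set.mem_Icc, Set.mem_Ico]
    exact ⟨fun h => ⟨h.2.1, h.1⟩, fun h => ⟨h.2, h.1, h.2.le.trans ht.2⟩⟩
  rw [unitInterval.measurePreserving_coe.integral_comp unitInterval.measurableEmbedding_coe,
    integral_indicator measurableSet_Iio, Measure.restrict_restrict measurableSet_Iio, hset,
    intervalIntegral.integral_of_le ht.1, integral_Ico_eq_integral_Ioo,
    integral_Ioc_eq_integral_Ioo]

theorem norm_pow_one_sub_le_one {s : ℝ} (hs : s ∈ Set.Icc (0 : ℝ) 1) (m : ℕ) :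
    ‖(1 - s) ^ m‖ ≤ 1 := by
  have hs' := Set.Icc.mem_iff_one_sub_mem.1 hs
  rw [norm_pow, Real.norm_of_nonneg hs'.1]
  exact pow_le_one₀ hs'.1 hs'.2

section Law

variable {T : Type*}

/-- The configurations in `A` in which the root has a label below `t`. -/
def lowConfigs (A : Set (Config T)) (t : ℝ) : Set (Config T) :=
  {ω | ((ω []).2 : ℝ) < t ∧ ω ∈ A}

theorem measurableSet_lowConfigs {A : Set (Config T)} (hA : MeasurableSet A) (t : ℝ) :
    MeasurableSet (lowConfigs A t) :=
  (measurableSet_lt (f := fun ω : Config T => ((ω []).2 : ℝ)) (by fun_prop) measurable_const).inter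
    hA

theorem lowConfigs_rootFree_eq_preimage (A : Set (Config T)) (t : ℝ) :
    lowConfigs (rootFree A) t =
      (fun ω : Config T => (ω [], fun c : T × ℕ => subtree c ω)) ⁻¹' {p | (p.1.2 : ℝ) < t ∧
        ∀ c : T × ℕ, c.2 < p.1.1 c.1 → p.2 c ∉ lowConfigs A p.1.2} := by
  ext ω
  simp only [lowConfigs, Set.mem_preimage, Set.mem_ofPred_eq, not_and]
  rfl

theorem measurableSet_setOf_forall_notMem_lowConfigs [Countable T] {A : Set (Config T)}
    (hA : MeasurableSet A) (t : ℝ) :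
    MeasurableSet {p : ((T → ℕ) × unitInterval) × (T × ℕ → Config T) | (p.1.2 : ℝ) < t ∧
      ∀ c : T × ℕ, c.2 < p.1.1 c.1 → p.2 c ∉ lowConfigs A p.1.2} := by
  have hlabel : Measurable fun p : ((T → ℕ) × unitInterval) × (T × ℕ → Config T) =>
      (p.1.2 : ℝ) := by fun_prop
  refine measurableSet_setOfPred.2 ((measurableSet_lt hlabel measurable_const).mem.and
    (Measurable.forall fun c => Measurable.imp ?_ (Measurable.not ?_)))
  · have hnumber : Measurable fun p : ((T → ℕ) × unitInterval) × (T × ℕ → Config T) =>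
        p.1.1 c.1 := by fun_prop
    exact (measurableSet_lt measurable_const hnumber).mem
  · have hchild : Measurable fun p : ((T → ℕ) × unitInterval) × (T × ℕ → Config T) =>
        ((p.2 c []).2 : ℝ) := by fun_prop
    exact (measurableSet_lt hchild hlabel).mem.and (hA.mem.comp (by fun_prop))

variable (μ : T → T → Measure ℕ)

/-- The probability of `lowConfigs A t`, as a function of the type of the root. -/
noncomputable def lowProb (A : Set (Config T)) (t : ℝ) (τ : T) : ℝ :=
  (configLaw τ μ).real (lowConfigs A t)

theorem lowProb_empty : lowProb μ ∅ = 0 := by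
  ext t τ
  simp [lowProb, lowConfigs]

theorem lowProb_zero (A : Set (Config T)) : lowProb μ A 0 = 0 := by
  ext τ
  have hempty : lowConfigs A 0 = ∅ :=
    Set.eq_empty_of_forall_notMem fun ω hω => (ω []).2.2.1.not_gt hω.1
  rw [lowProb, hempty, measureReal_empty, Pi.zero_apply]

variable [∀ k j, IsProbabilityMeasure (μ k j)]

theorem configLaw_map_root_label (τ : T) :
    (configLaw τ μ).map (fun ω => (ω []).2) = volume := by
  have hroot := Measure.infinitePi_map_eval (fun v => vertexLaw (nodeType τ v) μ) []
  calc _ = ((configLaw τ μ).map fun ω => ω []).map Prod.snd :=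
        (Measure.map_map measurable_snd (measurable_pi_apply [])).symm
    _ = _ := by rw [configLaw, hroot, vertexLaw]; exact measurePreserving_snd.map_eq

theorem lowProb_mem_Icc (A : Set (Config T)) (t : ℝ) : lowProb μ A t ∈ Set.Icc 0 1 :=
  ⟨fun _ => measureReal_nonneg, fun _ => measureReal_le_one⟩

theorem lowProb_one (A : Set (Config T)) (τ : T) :
    lowProb μ A 1 τ = (configLaw τ μ).real A := by
  have hlt : ∀ᵐ ω ∂configLaw τ μ, (ω []).2 ≠ 1 := by
    have hne := Measure.ae_ne (volume : Measure unitInterval) 1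
    rw [← configLaw_map_root_label μ τ] at hne
    exact ae_of_ae_map (f := fun ω : Config T => (ω []).2)
      (Measurable.aemeasurable (by fun_prop)) hne
  refine measureReal_congr ?_
  filter_upwards [hlt] with ω hω
  exact propext (and_iff_right (lt_of_le_of_ne (ω []).2.2.2 fun h => hω (Subtype.ext h)))

theorem lipschitzWith_lowProb (A : Set (Config T)) (τ : T) :
    LipschitzWith 1 fun t => lowProb μ A t τ := by
  refine LipschitzWith.of_le_add fun t s => ?_
  have hroot : (configLaw τ μ).real {ω | ((ω []).2 : ℝ) ∈ Set.Ico s t} ≤ dist t s := by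
    have hmeas : Measurable fun ω : Config T => ((ω []).2 : ℝ) := by fun_prop
    have hlaw : (configLaw τ μ).map (fun ω => ((ω []).2 : ℝ)) = volume.restrict unitInterval := by
      rw [← unitInterval.measurePreserving_coe.map_eq, ← configLaw_map_root_label μ τ,
        Measure.map_map (by fun_prop) (by fun_prop)]
      rfl
    calc _ = (volume.restrict unitInterval).real (Set.Ico s t) := by
          rw [← hlaw, map_measureReal_apply hmeas measurableSet_Ico]
          rfl
      _ ≤ volume.real (Set.Ico s t) :=
          ENNReal.toReal_mono measure_Ico_lt_top.ne (Measure.restrict_apply_le _ _)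
      _ ≤ dist t s := by
          rw [Real.volume_real_Ico]
          exact max_le (le_abs_self _) dist_nonneg
  refine le_trans ?_ (add_le_add_right hroot _)
  refine (measureReal_mono fun ω hω => ?_).trans (measureReal_union_le _ _)
  exact (lt_or_ge ((ω []).2 : ℝ) s).imp (fun h => ⟨h, hω.2⟩) fun h => ⟨h, hω.1⟩

theorem continuous_lowProb (A : Set (Config T)) : Continuous (lowProb μ A) :=
  continuous_pi fun τ => (lipschitzWith_lowProb μ A τ).continuous

theorem lowProb_compl {A : Set (Config T)} (hA : MeasurableSet A) :
    lowProb μ Aᶜ = lowProb μ Set.univ - lowProb μ A := by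
  ext t τ
  have hsplit := measureReal_inter_add_sdiff (μ := configLaw τ μ)
    (s := {ω : Config T | ((ω []).2 : ℝ) < t}) hA
  rw [Pi.sub_apply, Pi.sub_apply, eq_sub_iff_add_eq']
  simp only [lowProb, lowConfigs, Set.mem_univ, and_true]
  exact hsplit

end Law

section Recursion

variable {T : Type*} [Fintype T]

theorem infinitePi_real_forall_lt {X : Type*} [MeasurableSpace X] (Q : T → Measure X)
    [∀ j, IsProbabilityMeasure (Q j)] (m : T → ℕ) {B : T → Set X} (hB : ∀ j, MeasurableSet (B j)) :
    (Measure.infinitePi fun c : T × ℕ => Q c.1).real {η | ∀ c : T × ℕ, c.2 < m c.1 → η c ∈ B c.1} =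
      ∏ j, (Q j).real (B j) ^ m j := by
  let S : Finset (T × ℕ) := (Finset.univ.sigma fun j => Finset.range (m j)).map
    (Equiv.sigmaEquivProd T ℕ).toEmbedding
  have hset : {η : T × ℕ → X | ∀ c : T × ℕ, c.2 < m c.1 → η c ∈ B c.1} =
      (S : Set (T × ℕ)).pi fun c => B c.1 := by
    ext η
    refine forall_congr' fun ⟨j, i⟩ => imp_congr_left ?_
    simp [S]
  rw [hset, measureReal_def, Measure.infinitePi_pi _ fun c _ => hB c.1, ENNReal.toReal_prod]
  simp [S, Finset.prod_sigma, measureReal_def]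

variable (μ : T → T → Measure ℕ)

/-- The probability that a vertex, as a function of its type, has no marked child, when its
children of type `j` are marked independently with probability `s j`. -/
noncomputable def unmarkedProb (s : T → ℝ) (τ : T) : ℝ :=
  ∏ j, ∫ m, (1 - s j) ^ m ∂μ τ j

variable [∀ k j, IsProbabilityMeasure (μ k j)]

theorem lowProb_rootFree_eq_integral_vertexLaw {A : Set (Config T)} (hA : MeasurableSet A) (t : ℝ)
    (τ : T) :
    lowProb μ (rootFree A) t τ = ∫ p, (Set.Iio t).indicator
      (fun s => ∏ j, (1 - lowProb μ A s j) ^ p.1 j) p.2 ∂vertexLaw τ μ := by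
  have hroot : Measurable fun ω : Config T => (ω [], fun c : T × ℕ => subtree c ω) := by
    unfold subtree
    fun_prop
  have hD := measurableSet_setOf_forall_notMem_lowConfigs hA t
  rw [lowProb, lowConfigs_rootFree_eq_preimage, ← map_measureReal_apply hroot hD,
    configLaw_map_subtree, measureReal_prod_apply hD]
  refine integral_congr_ae (Eventually.of_forall fun p => ?_)
  beta_reduce
  by_cases hp : (p.2 : ℝ) < t
  · have hfibre : {η : T × ℕ → Config T | (p.2 : ℝ) < t ∧
        ∀ c : T × ℕ, c.2 < p.1 c.1 → η c ∉ lowConfigs A p.2} =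
        {η | ∀ c : T × ℕ, c.2 < p.1 c.1 → η c ∈ (lowConfigs A p.2)ᶜ} :=
      Set.ext fun η => and_iff_right hp
    rw [Set.indicator_of_mem (Set.mem_Iio.2 hp), Set.preimage_ofPred_eq, hfibre,
      infinitePi_real_forall_lt (fun j => configLaw j μ) p.1
        fun _ => (measurableSet_lowConfigs hA p.2).compl]
    simp only [probReal_compl_eq_one_sub (measurableSet_lowConfigs hA _), lowProb]
  · rw [Set.indicator_of_notMem (Set.notMem_Iio.2 (not_lt.1 hp))]
    simp only [Set.preimage_ofPred_eq, hp, false_and, Set.ofPred_false, measureReal_empty]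

theorem lowProb_rootFree {A : Set (Config T)} (hA : MeasurableSet A) (τ : T) {t : ℝ}
    (ht : t ∈ Set.Icc (0 : ℝ) 1) :
    lowProb μ (rootFree A) t τ = ∫ s in (0 : ℝ)..t, unmarkedProb μ (lowProb μ A s) τ := by
  have hoff : ∀ s, ∫ m : T → ℕ, ∏ j, (1 - lowProb μ A s j) ^ m j
      ∂Measure.infinitePi (fun j => μ τ j) = unmarkedProb μ (lowProb μ A s) τ := fun s => by
    rw [Measure.infinitePi_eq_pi, unmarkedProb]
    exact integral_fintype_prod_eq_prod fun j m => (1 - lowProb μ A s j) ^ m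
  rw [lowProb_rootFree_eq_integral_vertexLaw μ hA, vertexLaw, integral_prod_symm,
    ← integral_indicator_Iio_unitInterval _ ht]
  · refine integral_congr_ae (Eventually.of_forall fun y => ?_)
    by_cases hy : (y : ℝ) < t
    · simp only [Set.indicator_of_mem (Set.mem_Iio.2 hy), hoff]
    · simp only [Set.indicator_of_notMem (Set.notMem_Iio.2 (not_lt.1 hy)), integral_zero]
  · have hmeas : Measurable fun p : (T → ℕ) × unitInterval =>
        ∏ j, (1 - lowProb μ A p.2 j) ^ p.1 j :=
      Finset.measurable_prod _ fun j _ => Measurable.pow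
        (measurable_const.sub ((lipschitzWith_lowProb μ A j).continuous.measurable.comp
          (by fun_prop))) (by fun_prop)
    have hset : MeasurableSet {p : (T → ℕ) × unitInterval | (p.2 : ℝ) < t} :=
      measurableSet_lt (by fun_prop) measurable_const
    refine Integrable.of_bound (C := 1) (hmeas.indicator hset).aestronglyMeasurable
      (Eventually.of_forall fun p => ?_)
    refine (norm_indicator_le_norm_self _ _).trans ?_
    rw [norm_prod]
    exact Finset.prod_le_one (fun _ _ => norm_nonneg _) fun j _ => norm_pow_one_sub_le_one
      ⟨(lowProb_mem_Icc μ A p.2).1 j, (lowProb_mem_Icc μ A p.2).2 j⟩ _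

end Recursion

/-! ### The differential equation of the recursion -/

theorem abs_prod_sub_prod_le {ι : Type*} (s : Finset ι) {a b : ι → ℝ} (ha : ∀ i, |a i| ≤ 1)
    (hb : ∀ i, |b i| ≤ 1) : |∏ i ∈ s, a i - ∏ i ∈ s, b i| ≤ ∑ i ∈ s, |a i - b i| := by
  classical
  induction s using Finset.induction_on with
  | empty => simp
  | insert i s hi ih =>
    rw [Finset.prod_insert hi, Finset.prod_insert hi, Finset.sum_insert hi]
    have hprod : |∏ j ∈ s, b j| ≤ 1 := by
      rw [Finset.abs_prod]
      exact Finset.prod_le_one (fun _ _ => abs_nonneg _) fun j _ => hb j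
    calc |a i * ∏ j ∈ s, a j - b i * ∏ j ∈ s, b j|
        = |(a i - b i) * ∏ j ∈ s, b j + a i * (∏ j ∈ s, a j - ∏ j ∈ s, b j)| := by ring_nf
      _ ≤ |a i - b i| * |∏ j ∈ s, b j| + |a i| * |∏ j ∈ s, a j - ∏ j ∈ s, b j| := by
        rw [← abs_mul, ← abs_mul]
        exact abs_add_le _ _
      _ ≤ _ := add_le_add (mul_le_of_le_one_right (abs_nonneg _) hprod)
        ((mul_le_of_le_one_left (abs_nonneg _) (ha i)).trans ih)

theorem integrable_pow_one_sub (ν : Measure ℕ) [IsProbabilityMeasure ν] {s : ℝ}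
    (hs : s ∈ Set.Icc (0 : ℝ) 1) : Integrable (fun m => (1 - s) ^ m) ν :=
  Integrable.of_bound (measurable_of_countable _).aestronglyMeasurable 1
    (Eventually.of_forall (norm_pow_one_sub_le_one hs))

theorem abs_integral_pow_one_sub_le_one (ν : Measure ℕ) [IsProbabilityMeasure ν] {s : ℝ}
    (hs : s ∈ Set.Icc (0 : ℝ) 1) : |∫ m, (1 - s) ^ m ∂ν| ≤ 1 := by
  have hbound : ‖∫ m, (1 - s) ^ m ∂ν‖ ≤ 1 * ν.real Set.univ :=
    norm_integral_le_of_norm_le_const (Eventually.of_forall (norm_pow_one_sub_le_one hs))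
  rwa [probReal_univ, mul_one] at hbound

theorem abs_integral_pow_one_sub_sub_le {ν : Measure ℕ} [IsProbabilityMeasure ν]
    (hν : Integrable (fun m : ℕ => (m : ℝ)) ν) {s t : ℝ} (hs : s ∈ Set.Icc (0 : ℝ) 1)
    (ht : t ∈ Set.Icc (0 : ℝ) 1) :
    |∫ m, (1 - s) ^ m ∂ν - ∫ m, (1 - t) ^ m ∂ν| ≤ (∫ m, (m : ℝ) ∂ν) * |s - t| := by
  rw [← integral_sub (integrable_pow_one_sub ν hs) (integrable_pow_one_sub ν ht),
    ← integral_mul_const]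
  refine norm_integral_le_of_norm_le (f := fun m : ℕ => (1 - s) ^ m - (1 - t) ^ m)
    (hν.mul_const _) (Eventually.of_forall fun m => ?_)
  have hs' := Set.Icc.mem_iff_one_sub_mem.1 hs
  have ht' := Set.Icc.mem_iff_one_sub_mem.1 ht
  have hmax : max |1 - s| |1 - t| ^ (m - 1) ≤ 1 :=
    pow_le_one₀ (le_max_of_le_left (abs_nonneg _))
      (max_le (abs_le.2 ⟨by linarith [hs'.1], hs'.2⟩) (abs_le.2 ⟨by linarith [ht'.1], ht'.2⟩))
  calc |(1 - s) ^ m - (1 - t) ^ m|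
      ≤ |1 - s - (1 - t)| * m * max |1 - s| |1 - t| ^ (m - 1) := abs_pow_sub_pow_le ..
    _ ≤ |1 - s - (1 - t)| * m := mul_le_of_le_one_right (by positivity) hmax
    _ = m * |s - t| := by rw [sub_sub_sub_cancel_left, abs_sub_comm, mul_comm]

section Uniqueness

variable {T : Type*} [Fintype T] {μ : T → T → Measure ℕ} [∀ k j, IsProbabilityMeasure (μ k j)]

theorem exists_lipschitzOnWith_unmarkedProb
    (hμ : ∀ k j, Integrable (fun m : ℕ => (m : ℝ)) (μ k j)) :
    ∃ K, LipschitzOnWith K (unmarkedProb μ) (Set.Icc 0 1) := by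
  let mean (τ j : T) : ℝ≥0 := (∫ m, (m : ℝ) ∂μ τ j).toNNReal
  refine ⟨∑ τ, ∑ j, mean τ j, LipschitzOnWith.of_dist_le_mul fun s hs t ht => ?_⟩
  have hs' : ∀ j, s j ∈ Set.Icc (0 : ℝ) 1 := fun j => ⟨hs.1 j, hs.2 j⟩
  have ht' : ∀ j, t j ∈ Set.Icc (0 : ℝ) 1 := fun j => ⟨ht.1 j, ht.2 j⟩
  refine (dist_pi_le_iff (by positivity)).2 fun τ => ?_
  calc |unmarkedProb μ s τ - unmarkedProb μ t τ|
      ≤ ∑ j, |∫ m, (1 - s j) ^ m ∂μ τ j - ∫ m, (1 - t j) ^ m ∂μ τ j| :=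
        abs_prod_sub_prod_le _ (fun j => abs_integral_pow_one_sub_le_one _ (hs' j))
          fun j => abs_integral_pow_one_sub_le_one _ (ht' j)
    _ ≤ ∑ j, mean τ j * dist s t := by
        refine Finset.sum_le_sum fun j _ =>
          (abs_integral_pow_one_sub_sub_le (hμ τ j) (hs' j) (ht' j)).trans ?_
        exact mul_le_mul (Real.le_coe_toNNReal _) (dist_le_pi_dist s t j) (abs_nonneg _)
          (NNReal.coe_nonneg _)
    _ = (∑ j, mean τ j : ℝ≥0) * dist s t := by rw [← Finset.sum_mul, NNReal.coe_sum]
    _ ≤ _ := by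
        refine mul_le_mul_of_nonneg_right (NNReal.coe_le_coe.2 ?_) dist_nonneg
        exact Finset.single_le_sum (f := fun τ => ∑ j, mean τ j) (fun _ _ => zero_le)
          (Finset.mem_univ τ)

theorem hasDerivWithinAt_lowProb_rootFree (hμ : ∀ k j, Integrable (fun m : ℕ => (m : ℝ)) (μ k j))
    {A : Set (Config T)} (hA : MeasurableSet A) {t : ℝ} (ht : t ∈ Set.Ico (0 : ℝ) 1) :
    HasDerivWithinAt (lowProb μ (rootFree A)) (unmarkedProb μ (lowProb μ A t)) (Set.Ici t) t := by
  obtain ⟨K, hK⟩ := exists_lipschitzOnWith_unmarkedProb hμ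
  refine hasDerivWithinAt_pi.2 fun τ => ?_
  have hcont : Continuous fun s => unmarkedProb μ (lowProb μ A s) τ :=
    (continuous_apply τ).comp (hK.continuousOn.comp_continuous (continuous_lowProb μ A)
      fun s => lowProb_mem_Icc μ A s)
  have hderiv := (intervalIntegral.integral_hasDerivAt_right (hcont.intervalIntegrable 0 t)
    hcont.aestronglyMeasurable.stronglyMeasurableAtFilter hcont.continuousAt).hasDerivWithinAt
    (s := Set.Ici t)
  refine hderiv.congr_of_eventuallyEq_of_mem ?_ Set.self_mem_Ici
  filter_upwards [Ico_mem_nhdsGE ht.2] with s hs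
  exact lowProb_rootFree μ hA τ ⟨ht.1.trans hs.1, hs.2.le⟩

end Uniqueness

section Nonexplosive

variable {T : Type*} [Finite T] {μ : T → T → Measure ℕ} [∀ k j, IsProbabilityMeasure (μ k j)]

theorem lowProb_infinitePast_eq_zero (hμ : ∀ k j, Integrable (fun m : ℕ => (m : ℝ)) (μ k j))
    {t : ℝ} (ht : t ∈ Set.Icc (0 : ℝ) 1) : lowProb μ (infinitePast T) t = 0 := by
  cases nonempty_fintype T
  obtain ⟨K, hK⟩ := exists_lipschitzOnWith_unmarkedProb hμ
  have hinf : MeasurableSet (infinitePast T) := measurableSet_infinitePast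
  have hsub : lowProb μ (infinitePast T) =
      lowProb μ (rootFree ∅) - lowProb μ (rootFree (infinitePast T)) := by
    rw [rootFree_empty, ← lowProb_compl μ (measurableSet_rootFree hinf),
      ← infinitePast_eq_compl_rootFree]
  refine ODE_solution_unique_of_mem_Icc_right
    (v := fun _ z => unmarkedProb μ 0 - unmarkedProb μ z) (s := fun _ => Set.Icc 0 1)
    (g := fun _ => 0) (fun t _ => (LipschitzWith.const _).lipschitzOnWith.sub hK)
    (continuous_lowProb μ _).continuousOn (fun t ht => ?_)
    (fun t _ => lowProb_mem_Icc μ _ t) continuousOn_const (fun t _ => ?_)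
    (fun t _ => Set.left_mem_Icc.2 zero_le_one) (lowProb_zero μ _) ht
  · have hderiv := (hasDerivWithinAt_lowProb_rootFree hμ MeasurableSet.empty ht).sub
      (hasDerivWithinAt_lowProb_rootFree hμ hinf ht)
    rwa [← hsub, lowProb_empty] at hderiv
  · rw [sub_self]
    exact hasDerivWithinAt_const t _ 0

theorem configLaw_infinitePast (hμ : ∀ k j, Integrable (fun m : ℕ => (m : ℝ)) (μ k j)) (τ : T) :
    (configLaw τ μ).real (infinitePast T) = 0 := by
  rw [← lowProb_one, lowProb_infinitePast_eq_zero hμ (Set.right_mem_Icc.2 zero_le_one)]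
  rfl

theorem bpNonexplosive_of_integrable (hμ : ∀ k j, Integrable (fun m : ℕ => (m : ℝ)) (μ k j))
    (τ : T) : BPNonexplosive τ μ :=
  (bpNonexplosive_iff τ μ).2 (configLaw_infinitePast hμ τ)

theorem lowProb_occupied (hμ : ∀ k j, Integrable (fun m : ℕ => (m : ℝ)) (μ k j)) :
    lowProb μ (occupied T) = lowProb μ (rootFree (occupied T)) := by
  ext t τ
  have hfinite : ∀ᵐ ω ∂configLaw τ μ, ω ∉ infinitePast T :=
    measure_eq_zero_iff_ae_notMem.1 ((measureReal_eq_zero_iff).1 (configLaw_infinitePast hμ τ))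
  refine measureReal_congr ?_
  filter_upwards [hfinite, ae_injective_labels τ μ] with ω hω hinj
  exact propext (and_congr_right fun _ => mem_occupied_iff_mem_rootFree hinj hω)

end Nonexplosive

theorem bpIota_eq_of_hasDerivAt {T : Type*} [Fintype T] {μ : T → T → Measure ℕ}
    [∀ k j, IsProbabilityMeasure (μ k j)]
    (hμ : ∀ k j, Integrable (fun m : ℕ => (m : ℝ)) (μ k j)) {F : ℝ → T → ℝ} (hzero : F 0 = 0)
    (hmem : ∀ t ∈ Set.Icc (0 : ℝ) 1, F t ∈ Set.Icc 0 1)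
    (hF : ∀ t ∈ Set.Icc (0 : ℝ) 1, HasDerivAt F (unmarkedProb μ (F t)) t) (τ : T) :
    bpIota τ μ = F 1 τ := by
  obtain ⟨K, hK⟩ := exists_lipschitzOnWith_unmarkedProb hμ
  have heq : Set.EqOn (lowProb μ (occupied T)) F (Set.Icc 0 1) := by
    refine ODE_solution_unique_of_mem_Icc_right (v := fun _ => unmarkedProb μ)
      (s := fun _ => Set.Icc 0 1) (fun _ _ => hK) (continuous_lowProb μ _).continuousOn
      (fun t ht => ?_) (fun t _ => lowProb_mem_Icc μ _ t)
      (fun t ht => (hF t ht).continuousAt.continuousWithinAt)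
      (fun t ht => (hF t (Set.Ico_subset_Icc_self ht)).hasDerivWithinAt)
      (fun t ht => hmem t (Set.Ico_subset_Icc_self ht)) ((lowProb_zero μ _).trans hzero.symm)
    have hderiv := hasDerivWithinAt_lowProb_rootFree hμ measurableSet_occupied ht
    rwa [← lowProb_occupied hμ] at hderiv
  rw [bpIota_eq, ← lowProb_one, heq (Set.right_mem_Icc.2 zero_le_one)]

/-! ### Poisson Galton–Watson trees -/

theorem integral_pow_poissonMeasure (lam : ℝ≥0) (s : ℝ) :
    ∫ m, (1 - s) ^ m ∂poissonMeasure lam = Real.exp (-(lam * s)) := by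
  rw [integral_poissonMeasure]
  have hsum := (NormedSpace.expSeries_div_hasSum_exp ((lam : ℝ) * (1 - s))).mul_left
    (Real.exp (-lam))
  rw [← Real.exp_eq_exp_ℝ, ← Real.exp_add] at hsum
  have hexp : -((lam : ℝ) * s) = -lam + lam * (1 - s) := by ring
  rw [hexp, ← hsum.tsum_eq]
  refine tsum_congr fun m => ?_
  rw [mul_pow, smul_eq_mul]
  ring

instance (lam : ℝ≥0) (k j : Unit) : IsProbabilityMeasure (gwOffspring lam k j) := by
  unfold gwOffspring; infer_instance

instance (lam : ℝ≥0) (k j : SBType) : IsProbabilityMeasure (sbgwOffspring lam k j) := by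
  cases k <;> cases j <;> unfold sbgwOffspring <;> infer_instance

instance : Fintype SBType :=
  ⟨⟨{.spine, .tree}, by simp⟩, by rintro (_ | _) <;> simp⟩

theorem prod_sbType (f : SBType → ℝ) : ∏ j, f j = f .spine * f .tree := by
  simp [Finset.univ, Fintype.elems]

theorem unmarkedProb_gwOffspring (lam : ℝ≥0) (s : Unit → ℝ) (τ : Unit) :
    unmarkedProb (gwOffspring lam) s τ = Real.exp (-(lam * s ())) := by
  simp [unmarkedProb, gwOffspring, integral_pow_poissonMeasure]

theorem unmarkedProb_sbgwOffspring_spine (lam : ℝ≥0) (s : SBType → ℝ) :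
    unmarkedProb (sbgwOffspring lam) s .spine =
      (1 - s .spine) * Real.exp (-(lam * s .tree)) := by
  simp [unmarkedProb, prod_sbType, sbgwOffspring, integral_pow_poissonMeasure]

theorem unmarkedProb_sbgwOffspring_tree (lam : ℝ≥0) (s : SBType → ℝ) :
    unmarkedProb (sbgwOffspring lam) s .tree = Real.exp (-(lam * s .tree)) := by
  simp [unmarkedProb, prod_sbType, sbgwOffspring, integral_pow_poissonMeasure]

theorem integrable_natCast_poissonMeasure (lam : ℝ≥0) :
    Integrable (fun m : ℕ => (m : ℝ)) (poissonMeasure lam) := by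
  rw [integrable_poissonMeasure_iff, ← summable_nat_add_iff 1]
  refine ((Real.summable_pow_div_factorial lam).mul_left (Real.exp (-lam) * lam)).congr fun m => ?_
  rw [Real.norm_natCast, Nat.factorial_succ, Nat.cast_mul]
  field_simp
  ring

theorem integrable_natCast_gwOffspring (lam : ℝ≥0) (k j : Unit) :
    Integrable (fun m : ℕ => (m : ℝ)) (gwOffspring lam k j) :=
  integrable_natCast_poissonMeasure lam

theorem integrable_natCast_sbgwOffspring (lam : ℝ≥0) (k j : SBType) :
    Integrable (fun m : ℕ => (m : ℝ)) (sbgwOffspring lam k j) := by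
  cases j with
  | spine => cases k <;> exact integrable_dirac (by simp)
  | tree => cases k <;> exact integrable_natCast_poissonMeasure lam

/-- The probability that the root of the Poisson Galton–Watson tree is occupied and has a label
below `t`. -/
noncomputable def gwLimit (lam t : ℝ) : ℝ := Real.log (1 + lam * t) / lam

/-- The analogue of `gwLimit` for the size-biased Poisson Galton–Watson tree, as a function of the
type of the root. -/
noncomputable def sbgwLimit (lam t : ℝ) : SBType → ℝ
  | .spine => 1 - Real.exp (-gwLimit lam t)
  | .tree => gwLimit lam t

section Limit

variable {lam t : ℝ}

theorem gwLimit_zero (lam : ℝ) : gwLimit lam 0 = 0 := by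
  simp [gwLimit]

theorem exp_neg_mul_gwLimit (hlam : 0 < lam) (ht : 0 ≤ t) :
    Real.exp (-(lam * gwLimit lam t)) = (1 + lam * t)⁻¹ := by
  have hpos : 0 < 1 + lam * t := by positivity
  rw [gwLimit, mul_div_cancel₀ _ hlam.ne', Real.exp_neg, Real.exp_log hpos]

theorem hasDerivAt_gwLimit (hlam : 0 < lam) (ht : 0 ≤ t) :
    HasDerivAt (gwLimit lam) (Real.exp (-(lam * gwLimit lam t))) t := by
  have hpos : 0 < 1 + lam * t := by positivity
  have hderiv := ((((hasDerivAt_id t).const_mul lam).const_add 1).log hpos.ne').div_const lam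
  refine hderiv.congr_deriv ?_
  rw [exp_neg_mul_gwLimit hlam ht, mul_one, div_right_comm, div_self hlam.ne', one_div]
  rfl

theorem gwLimit_mem_Icc (hlam : 0 < lam) (ht : 0 ≤ t) : gwLimit lam t ∈ Set.Icc 0 t := by
  have hnonneg : 0 ≤ lam * t := by positivity
  refine ⟨div_nonneg (Real.log_nonneg (by linarith)) hlam.le, ?_⟩
  rw [gwLimit, div_le_iff₀ hlam]
  linarith [Real.log_le_sub_one_of_pos (show 0 < 1 + lam * t by positivity)]

theorem sbgwLimit_mem_Icc (hlam : 0 < lam) (ht : 0 ≤ t) (ht' : t ≤ 1) (τ : SBType) :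
    sbgwLimit lam t τ ∈ Set.Icc (0 : ℝ) 1 := by
  have hmem := gwLimit_mem_Icc hlam ht
  cases τ with
  | spine =>
    exact ⟨sub_nonneg.2 (Real.exp_le_one_iff.2 (neg_nonpos.2 hmem.1)),
      sub_le_self _ (Real.exp_pos _).le⟩
  | tree => exact ⟨hmem.1, hmem.2.trans ht'⟩

end Limit

section Iota

variable {lam : ℝ≥0}

theorem bpIota_gwOffspring (hlam : 0 < lam) : bpIota () (gwOffspring lam) = gwLimit lam 1 := by
  have hlam' : (0 : ℝ) < lam := hlam
  refine bpIota_eq_of_hasDerivAt (integrable_natCast_gwOffspring lam)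
    (F := fun t _ => gwLimit lam t) (funext fun _ => gwLimit_zero _) (fun t ht => ?_)
    (fun t ht => hasDerivAt_pi.2 fun τ => ?_) ()
  · have hmem := gwLimit_mem_Icc hlam' ht.1
    exact ⟨fun _ => hmem.1, fun _ => hmem.2.trans ht.2⟩
  · rw [unmarkedProb_gwOffspring]
    exact hasDerivAt_gwLimit hlam' ht.1

theorem bpIota_sbgwOffspring (hlam : 0 < lam) :
    bpIota .spine (sbgwOffspring lam) = 1 - Real.exp (-gwLimit lam 1) := by
  have hlam' : (0 : ℝ) < lam := hlam
  refine bpIota_eq_of_hasDerivAt (integrable_natCast_sbgwOffspring lam) (F := sbgwLimit lam)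
    (funext fun τ => ?_) (fun t ht => ?_) (fun t ht => hasDerivAt_pi.2 fun τ => ?_) .spine
  · cases τ <;> simp [sbgwLimit, gwLimit_zero]
  · exact ⟨fun τ => (sbgwLimit_mem_Icc hlam' ht.1 ht.2 τ).1,
      fun τ => (sbgwLimit_mem_Icc hlam' ht.1 ht.2 τ).2⟩
  · have hderiv := hasDerivAt_gwLimit hlam' ht.1
    cases τ with
    | spine =>
      rw [unmarkedProb_sbgwOffspring_spine]
      refine (hderiv.neg.exp.const_sub 1).congr_deriv ?_
      simp only [sbgwLimit, Pi.neg_apply, sub_sub_cancel, mul_neg, neg_neg]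
    | tree =>
      rw [unmarkedProb_sbgwOffspring_tree]
      exact hderiv

theorem bpIota_sbgwOffspring_eq_rpow (hlam : 0 < lam) :
    bpIota .spine (sbgwOffspring lam) = 1 - (1 + (lam : ℝ)) ^ (-1 / (lam : ℝ)) := by
  rw [bpIota_sbgwOffspring hlam, Real.rpow_def_of_pos (by positivity), gwLimit, mul_one]
  congr 2
  ring

theorem bpIota_sbgwOffspring_one : bpIota .spine (sbgwOffspring 1) = 1 / 2 := by
  rw [bpIota_sbgwOffspring_eq_rpow one_pos]
  norm_num [Real.rpow_neg_one]

end Iota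

/-! ### Greedy exploration of a functional graph -/

section Exploration

variable {n : ℕ} {f g : Fin n → Fin n} {k : ℕ} {u v x : Fin n}

theorem functionalGraph_adj : (functionalGraph f).Adj u v ↔ u ≠ v ∧ (f u = v ∨ f v = u) := by
  rw [functionalGraph, SimpleGraph.fromRel_adj]

theorem functionalGraph_comap (f : Fin n → Fin n) (π : Equiv.Perm (Fin n)) :
    (functionalGraph f).comap π = functionalGraph (π.symm ∘ f ∘ π) := by
  ext u v
  simp only [SimpleGraph.comap_adj, functionalGraph_adj, ne_eq, π.injective.eq_iff,
    Function.comp_apply, Equiv.symm_apply_eq]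

/-- The greedy independent set of `functionalGraph f` after the vertices `0, …, k - 1` have been
considered in this order. -/
def selected (f : Fin n → Fin n) : ℕ → Finset (Fin n)
  | 0 => ∅
  | k + 1 =>
    let S := selected f k
    S ∪ Finset.univ.filter fun v => (v : ℕ) = k ∧ v ∉ S.image f ∧ f v ∉ S

theorem mem_selected_succ : v ∈ selected f (k + 1) ↔
    v ∈ selected f k ∨ (v : ℕ) = k ∧ v ∉ (selected f k).image f ∧ f v ∉ selected f k := by
  rw [selected, Finset.mem_union, Finset.mem_filter_univ]

theorem lt_of_mem_selected (hv : v ∈ selected f k) : (v : ℕ) < k := by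
  induction k with
  | zero => simp only [selected, Finset.notMem_empty] at hv
  | succ k ih =>
    rcases mem_selected_succ.1 hv with hv | ⟨rfl, -⟩
    · exact (ih hv).trans k.lt_succ_self
    · exact Nat.lt_succ_self _

theorem image_selected_congr (h : ∀ u : Fin n, (u : ℕ) < k → f u = g u) :
    (selected f k).image f = (selected f k).image g :=
  Finset.image_congr fun u hu => h u (lt_of_mem_selected hu)

theorem selected_congr (h : ∀ u : Fin n, (u : ℕ) < k → f u = g u) :
    selected f k = selected g k := by
  induction k with
  | zero => rfl
  | succ k ih =>
    have hlt : ∀ u : Fin n, (u : ℕ) < k → f u = g u := fun u hu => h u (hu.trans k.lt_succ_self)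
    ext v
    rw [mem_selected_succ, mem_selected_succ, image_selected_congr hlt, ih hlt]
    refine or_congr_right (and_congr_right fun hv => ?_)
    rw [h v (hv ▸ k.lt_succ_self)]

theorem greedySet_take_finRange (f : Fin n → Fin n) {k : ℕ} (hk : k ≤ n) :
    greedySet (functionalGraph f) ((List.finRange n).take k) = selected f k := by
  induction k with
  | zero => simp only [List.take_zero, greedySet_nil, selected, Finset.coe_empty]
  | succ k ih =>
    have hkn : k < n := hk
    rw [List.take_succ_eq_append_getElem (by simpa using hkn), greedySet_concat, ih hkn.le]
    ext v
    simp only [List.getElem_finRange, Fin.cast_mk, Set.mem_union, Finset.mem_coe,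
      Set.mem_ofPred_eq, mem_selected_succ]
    refine or_congr_right ⟨?_, ?_⟩
    · rintro ⟨rfl, h⟩
      have hne : ∀ u ∈ selected f k, u ≠ ⟨k, hkn⟩ := by
        rintro u hu rfl
        exact lt_irrefl _ (lt_of_mem_selected hu)
      refine ⟨rfl, fun hv => ?_, fun hf => ?_⟩
      · obtain ⟨u, hu, huv⟩ := Finset.mem_image.1 hv
        exact h u hu (functionalGraph_adj.2 ⟨hne u hu, .inl huv⟩)
      · exact h _ hf (functionalGraph_adj.2 ⟨hne _ hf, .inr rfl⟩)
    · rintro ⟨rfl, himg, hf⟩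
      refine ⟨rfl, fun u hu hadj => ?_⟩
      rcases (functionalGraph_adj.1 hadj).2 with h | h
      · exact himg (Finset.mem_image.2 ⟨u, hu, h⟩)
      · exact hf (h ▸ hu)

theorem greedyRatio_functionalGraph (f : Fin n → Fin n) (π : Equiv.Perm (Fin n)) :
    greedyRatio (functionalGraph f) π = (selected (π.symm ∘ f ∘ π) n).card / n := by
  rw [greedyRatio, List.ofFn_eq_map, greedySet_map, functionalGraph_comap,
    Set.ncard_image_of_injective _ π.injective,
    ← List.take_of_length_le (List.length_finRange (n := n)).le, greedySet_take_finRange _ le_rfl,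
    Set.ncard_coe_finset]

/-- The vertices `w ≥ k` that are not hit by the vertices selected among `0, …, k - 1`. -/
def unhit (f : Fin n → Fin n) (k : ℕ) : Finset (Fin n) :=
  {w | k ≤ (w : ℕ) ∧ w ∉ (selected f k).image f}

theorem mem_unhit : v ∈ unhit f k ↔ k ≤ (v : ℕ) ∧ v ∉ (selected f k).image f :=
  Finset.mem_filter_univ v

theorem mem_unhit_self : v ∈ unhit f v ↔ v ∉ (selected f v).image f :=
  mem_unhit.trans (and_iff_right le_rfl)

theorem unhit_congr (h : ∀ u : Fin n, (u : ℕ) < k → f u = g u) : unhit f k = unhit g k := by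
  rw [unhit, unhit, image_selected_congr h, selected_congr h]

theorem selected_succ_of_notMem_unhit (hv : v ∉ unhit f v) :
    selected f (v + 1) = selected f v := by
  rw [mem_unhit_self, not_not] at hv
  ext u
  rw [mem_selected_succ, or_iff_left]
  rintro ⟨huv, hu, -⟩
  exact hu (Fin.ext huv ▸ hv)

theorem unhit_succ_of_notMem_unhit (hv : v ∉ unhit f v) : unhit f (v + 1) = unhit f v := by
  ext w
  rw [mem_unhit, selected_succ_of_notMem_unhit hv, mem_unhit]
  refine and_congr_left fun hw => Nat.succ_le_iff.trans (lt_iff_le_and_ne.trans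
    (and_iff_left fun hvw => ?_))
  exact hv (mem_unhit_self.2 (Fin.ext hvw ▸ hw))

theorem selected_succ_of_mem_selected (hfv : f v ∈ selected f v) :
    selected f (v + 1) = selected f v := by
  ext u
  rw [mem_selected_succ, or_iff_left]
  rintro ⟨huv, -, hu⟩
  exact hu (Fin.ext huv ▸ hfv)

theorem unhit_succ_of_mem_selected (hfv : f v ∈ selected f v) :
    unhit f (v + 1) = (unhit f v).erase v := by
  ext w
  rw [mem_unhit, selected_succ_of_mem_selected hfv, Finset.mem_erase, mem_unhit, ne_eq,
    Fin.ext_iff]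
  grind

theorem selected_succ_of_notMem_selected (hv : v ∈ unhit f v) (hfv : f v ∉ selected f v) :
    selected f (v + 1) = insert v (selected f v) := by
  ext u
  rw [mem_selected_succ, Finset.mem_insert, or_comm, Fin.ext_iff]
  refine or_congr_left (and_iff_left_of_imp fun huv => ?_)
  rw [Fin.ext huv]
  exact ⟨mem_unhit_self.1 hv, hfv⟩

theorem unhit_succ_of_notMem_selected (hv : v ∈ unhit f v) (hfv : f v ∉ selected f v) :
    unhit f (v + 1) = ((unhit f v).erase v).erase (f v) := by
  ext w
  rw [mem_unhit, selected_succ_of_notMem_selected hv hfv, Finset.image_insert, Finset.mem_insert,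
    Finset.mem_erase, Finset.mem_erase, mem_unhit, ne_eq w v, Fin.ext_iff (a := w) (b := v)]
  grind

/-- How far the exploration is from the fluid limit, in which the unhit vertices number
`n - 2 |selected|`. -/
def deviation (f : Fin n → Fin n) (k : ℕ) : ℤ :=
  (unhit f k).card + 2 * (selected f k).card - n

theorem deviation_zero (f : Fin n → Fin n) : deviation f 0 = 0 := by
  simp [deviation, unhit, selected]

theorem deviation_last (f : Fin n → Fin n) : deviation f n = 2 * (selected f n).card - n := by
  have : unhit f n = ∅ := Finset.eq_empty_of_forall_notMem fun w hw =>
    (mem_unhit.1 hw).1.not_gt w.isLt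
  rw [deviation, this, Finset.card_empty, Nat.cast_zero, zero_add]

theorem deviation_congr (h : ∀ u : Fin n, (u : ℕ) < k → f u = g u) :
    deviation f k = deviation g k := by
  rw [deviation, deviation, unhit_congr h, selected_congr h]

/-- The increment of `deviation` at the step of `v`, if `v` is unhit and is sent to `x`. -/
def increment (f : Fin n → Fin n) (v x : Fin n) : ℤ :=
  1 - (if x ∈ (unhit f v).erase v then 1 else 0) - (if x ∈ selected f v then 2 else 0)

theorem abs_increment_le (f : Fin n → Fin n) (v x : Fin n) : |increment f v x| ≤ 1 := by
  have hdisj : x ∈ (unhit f v).erase v → x ∉ selected f v := fun hx hx' =>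
    (mem_unhit.1 (Finset.mem_of_mem_erase hx)).1.not_gt (lt_of_mem_selected hx')
  rw [increment, abs_le]
  grind

theorem sum_increment (hv : v ∈ unhit f v) : ∑ x, increment f v x = 1 - deviation f v := by
  simp only [increment, Finset.sum_sub_distrib, Finset.sum_ite_mem, Finset.univ_inter,
    Finset.sum_const, nsmul_eq_mul, Finset.card_univ, Fintype.card_fin]
  rw [deviation, ← Finset.card_erase_add_one hv]
  push_cast
  ring

theorem deviation_succ_of_notMem_unhit (hv : v ∉ unhit f v) :
    deviation f (v + 1) = deviation f v := by
  rw [deviation, unhit_succ_of_notMem_unhit hv, selected_succ_of_notMem_unhit hv, deviation]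

theorem deviation_succ_of_mem_unhit (hv : v ∈ unhit f v) :
    deviation f (v + 1) = deviation f v + increment f v (f v) := by
  have herase := Finset.card_erase_add_one hv
  rw [deviation, deviation, increment]
  by_cases hfv : f v ∈ selected f v
  · have hfv' : f v ∉ (unhit f v).erase v := fun h =>
      (mem_unhit.1 (Finset.mem_of_mem_erase h)).1.not_gt (lt_of_mem_selected hfv)
    rw [unhit_succ_of_mem_selected hfv, selected_succ_of_mem_selected hfv, if_pos hfv,
      if_neg hfv']
    omega
  · have hv' : v ∉ selected f v := fun h => lt_irrefl _ (lt_of_mem_selected h)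
    rw [unhit_succ_of_notMem_selected hv hfv, selected_succ_of_notMem_selected hv hfv,
      Finset.card_insert_of_notMem hv', if_neg hfv, Finset.card_erase_eq_ite]
    split_ifs with hfv'
    · have := Finset.card_pos.2 ⟨_, hfv'⟩
      omega
    · omega

theorem update_eq_of_lt (x : Fin n) : ∀ u : Fin n, u < v → Function.update f v x u = f u :=
  fun _ hu => Function.update_of_ne hu.ne _ _

theorem deviation_update_succ_of_notMem_unhit (hv : v ∉ unhit f v) (x : Fin n) :
    deviation (Function.update f v x) (v + 1) = deviation f v := by
  rw [deviation_succ_of_notMem_unhit (by rwa [unhit_congr (update_eq_of_lt x)]),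
    deviation_congr (update_eq_of_lt x)]

theorem deviation_update_succ_of_mem_unhit (hv : v ∈ unhit f v) (x : Fin n) :
    deviation (Function.update f v x) (v + 1) = deviation f v + increment f v x := by
  rw [deviation_succ_of_mem_unhit (by rwa [unhit_congr (update_eq_of_lt x)]),
    deviation_congr (update_eq_of_lt x), Function.update_self, increment, increment,
    unhit_congr (update_eq_of_lt x), selected_congr (update_eq_of_lt x)]

end Exploration

/-! ### Concentration of the deviation -/

section Concentration

theorem card_mul_sum_eq_sum_update {ι α : Type*} [Fintype ι] [DecidableEq ι] [Fintype α]
    (i : ι) (g : (ι → α) → ℝ) :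
    (Fintype.card α : ℝ) * ∑ f, g f = ∑ f, ∑ x, g (Function.update f i x) := by
  let swap : (ι → α) × α → (ι → α) × α := fun p => (Function.update p.1 i p.2, p.1 i)
  have hswap : Function.Involutive swap := fun p => by
    simp only [swap, Function.update_idem, Function.update_self, Function.update_eq_self]
  calc (Fintype.card α : ℝ) * ∑ f, g f = ∑ p : (ι → α) × α, g p.1 := by
        simp only [Fintype.sum_prod_type, Finset.sum_const, Finset.card_univ, nsmul_eq_mul,
          Finset.mul_sum]
    _ = ∑ p : (ι → α) × α, g (swap p).1 :=
        (Equiv.sum_comp (hswap.toPerm swap) fun p => g p.1).symm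
    _ = ∑ f, ∑ x, g (Function.update f i x) := Fintype.sum_prod_type _

theorem exp_le_one_add_add_sq {y : ℝ} (hy : |y| ≤ 1) : Real.exp y ≤ 1 + y + y ^ 2 := by
  linarith [le_of_abs_le (Real.abs_exp_sub_one_sub_id_le hy)]

theorem neg_mul_exp_le_one (y : ℝ) : -y * Real.exp y ≤ 1 :=
  calc -y * Real.exp y ≤ Real.exp (-y) * Real.exp y := by
        gcongr
        linarith [Real.add_one_le_exp (-y)]
    _ = 1 := by rw [← Real.exp_add, neg_add_cancel, Real.exp_zero]

theorem sum_exp_mul_add_le {ι : Type*} [Fintype ι] {θ z : ℝ} {d : ι → ℝ} (hθ : |θ| ≤ 1)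
    (hd : ∀ x, |d x| ≤ 1) (hsum : ∑ x, d x = 1 - z) :
    ∑ x, Real.exp (θ * (z + d x)) ≤
      (Fintype.card ι * (1 + θ ^ 2) + |θ|) * Real.exp (θ * z) + 1 := by
  have hbound : ∀ x, Real.exp (θ * (z + d x)) ≤ Real.exp (θ * z) * (1 + θ * d x + θ ^ 2) := by
    intro x
    have hle : |θ * d x| ≤ 1 := abs_mul θ (d x) ▸ mul_le_one₀ hθ (abs_nonneg _) (hd x)
    have hsq : (θ * d x) ^ 2 ≤ θ ^ 2 :=
      mul_pow θ (d x) 2 ▸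
        mul_le_of_le_one_right (sq_nonneg θ) ((sq_le_one_iff_abs_le_one _).2 (hd x))
    rw [mul_add, Real.exp_add]
    gcongr
    linarith [exp_le_one_add_add_sq hle]
  calc ∑ x, Real.exp (θ * (z + d x))
      ≤ ∑ x, Real.exp (θ * z) * (1 + θ * d x + θ ^ 2) := Finset.sum_le_sum fun x _ => hbound x
    _ = (Fintype.card ι * (1 + θ ^ 2) + θ) * Real.exp (θ * z)
          + -(θ * z) * Real.exp (θ * z) := by
        rw [← Finset.mul_sum, Finset.sum_add_distrib, Finset.sum_add_distrib, ← Finset.mul_sum,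
          hsum, Finset.sum_const, Finset.sum_const, Finset.card_univ, nsmul_eq_mul, nsmul_eq_mul]
        ring
    _ ≤ _ := by
        gcongr
        · exact le_abs_self θ
        · exact neg_mul_exp_le_one _

variable {n : ℕ} {θ ε : ℝ}

theorem sum_exp_deviation_update_le (hθ : |θ| ≤ 1) (f : Fin n → Fin n) (v : Fin n) :
    ∑ x, Real.exp (θ * deviation (Function.update f v x) (v + 1)) ≤
      (n * (1 + θ ^ 2) + |θ|) * Real.exp (θ * deviation f v) + 1 := by
  by_cases hv : v ∈ unhit f v
  · have habs : ∀ x, |(increment f v x : ℝ)| ≤ 1 := fun x => by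
      exact_mod_cast abs_increment_le f v x
    have hsum : ∑ x, (increment f v x : ℝ) = 1 - deviation f v := by
      exact_mod_cast sum_increment hv
    simpa only [deviation_update_succ_of_mem_unhit hv, Int.cast_add, Fintype.card_fin] using
      sum_exp_mul_add_le hθ habs hsum
  · simp only [deviation_update_succ_of_notMem_unhit hv, Finset.sum_const, Finset.card_univ,
      Fintype.card_fin, nsmul_eq_mul]
    have : 0 ≤ (n * θ ^ 2 + |θ|) * Real.exp (θ * deviation f v) := by positivity
    linarith

theorem sum_exp_deviation_le (hθ : |θ| ≤ 1) {k : ℕ} (hk : k ≤ n) :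
    ∑ f : Fin n → Fin n, Real.exp (θ * deviation f k) ≤
      (n : ℝ) ^ n * ((1 + θ ^ 2 + |θ| / n) ^ k * (1 + k / n)) := by
  induction k with
  | zero => simp [deviation_zero]
  | succ k ih =>
    have hn : (0 : ℝ) < n := by exact_mod_cast k.succ_pos.trans_le hk
    set a := 1 + θ ^ 2 + |θ| / n with ha
    have one_le_a : 1 ≤ a := by
      rw [ha, add_assoc]
      exact le_add_of_nonneg_right (by positivity)
    have hstep : (n : ℝ) * ∑ f : Fin n → Fin n, Real.exp (θ * deviation f (k + 1)) ≤
        n * (a * ∑ f : Fin n → Fin n, Real.exp (θ * deviation f k) + n ^ n * (1 / n)) := by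
      have hsum := card_mul_sum_eq_sum_update (⟨k, hk⟩ : Fin n)
        fun f : Fin n → Fin n => Real.exp (θ * deviation f (k + 1))
      rw [Fintype.card_fin] at hsum
      refine hsum.trans_le ((Finset.sum_le_sum fun f _ =>
        sum_exp_deviation_update_le hθ f ⟨k, hk⟩).trans_eq ?_)
      rw [Finset.sum_add_distrib, ← Finset.mul_sum, Finset.sum_const, Finset.card_univ,
        Fintype.card_fun, Fintype.card_fin, nsmul_one, Nat.cast_pow, ha]
      field_simp
    calc ∑ f : Fin n → Fin n, Real.exp (θ * deviation f (k + 1))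
        ≤ a * ∑ f : Fin n → Fin n, Real.exp (θ * deviation f k) + n ^ n * (1 / n) :=
          le_of_mul_le_mul_left hstep hn
      _ ≤ a * (n ^ n * (a ^ k * (1 + k / n))) + n ^ n * (a ^ (k + 1) * (1 / n)) := by
          gcongr
          · exact ih (Nat.le_of_succ_le hk)
          · exact le_mul_of_one_le_left (by positivity) (one_le_pow₀ one_le_a)
      _ = _ := by push_cast; ring

theorem sum_exp_deviation_last_le [NeZero n] (hθ : |θ| ≤ 1) :
    ∑ f : Fin n → Fin n, Real.exp (θ * deviation f n) ≤
      n ^ n * (2 * Real.exp (n * θ ^ 2 + |θ|)) := by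
  have hn : (n : ℝ) ≠ 0 := NeZero.ne _
  calc ∑ f : Fin n → Fin n, Real.exp (θ * deviation f n)
      ≤ (n : ℝ) ^ n * ((1 + θ ^ 2 + |θ| / n) ^ n * (1 + n / n)) := sum_exp_deviation_le hθ le_rfl
    _ ≤ (n : ℝ) ^ n * (Real.exp (θ ^ 2 + |θ| / n) ^ n * (1 + n / n)) := by
        gcongr
        linarith [Real.add_one_le_exp (θ ^ 2 + |θ| / n)]
    _ = n ^ n * (2 * Real.exp (n * θ ^ 2 + |θ|)) := by
        rw [← Real.exp_nat_mul, div_self hn, one_add_one_eq_two, mul_add, mul_div_cancel₀ _ hn,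
          mul_comm 2]

theorem card_lt_abs_mul_exp_le {α : Type*} [Fintype α] (X : α → ℝ) (t : ℝ) (hθ : 0 ≤ θ) :
    (Finset.card {a | t < |X a|} : ℝ) * Real.exp (θ * t) ≤
      ∑ a, Real.exp (θ * X a) + ∑ a, Real.exp (-θ * X a) := by
  rw [← Finset.sum_add_distrib, ← nsmul_eq_mul]
  refine (Finset.card_nsmul_le_sum _ _ _ fun a ha => ?_).trans
    (Finset.sum_le_univ_sum_of_nonneg fun a => by positivity)
  calc Real.exp (θ * t) ≤ Real.exp |θ * X a| := by
        rw [abs_mul, abs_of_nonneg hθ]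
        gcongr
        exact (Finset.mem_filter.1 ha).2.le
    _ ≤ Real.exp (θ * X a) + Real.exp (-θ * X a) := by
        rw [neg_mul]
        exact Real.exp_abs_le _

theorem card_lt_abs_deviation_le [NeZero n] (hε : 0 ≤ ε) (hε' : ε ≤ 2) :
    (Finset.card {f : Fin n → Fin n | ε * n < |(deviation f n : ℝ)|} : ℝ) ≤
      n ^ n * (4 * Real.exp (1 - ε ^ 2 / 4 * n)) := by
  have hε₀ : 0 ≤ ε / 2 := by positivity
  have hθ : |ε / 2| = ε / 2 := abs_of_nonneg hε₀
  have hθ' : |ε / 2| ≤ 1 := by linarith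
  have hexponent : n * (ε / 2) ^ 2 + |ε / 2| ≤ 1 - ε ^ 2 / 4 * n + ε / 2 * (ε * n) := by
    linarith
  have hpos := sum_exp_deviation_last_le (n := n) hθ'
  have hneg := sum_exp_deviation_last_le (n := n) (θ := -(ε / 2)) (by rwa [abs_neg])
  rw [abs_neg, neg_sq] at hneg
  rw [← mul_le_mul_iff_of_pos_right (Real.exp_pos (ε / 2 * (ε * n)))]
  calc _ ≤ (n : ℝ) ^ n * (4 * Real.exp (n * (ε / 2) ^ 2 + |ε / 2|)) := by
        linarith [card_lt_abs_mul_exp_le (fun f : Fin n → Fin n => (deviation f n : ℝ)) (ε * n)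
          hε₀]
    _ ≤ (n : ℝ) ^ n * (4 * Real.exp (1 - ε ^ 2 / 4 * n + ε / 2 * (ε * n))) := by
        gcongr
    _ = _ := by
        rw [Real.exp_add]
        ring

/-- The maps `f` for which the greedy independence ratio of `functionalGraph f`, along the order
`π`, is not within a factor `1 ± ε` of `1 / 2`. -/
noncomputable def deviatingMaps (ε : ℝ) (π : Equiv.Perm (Fin n)) : Finset (Fin n → Fin n) :=
  {f | ε < |greedyRatio (functionalGraph f) π / (1 / 2) - 1|}

theorem mem_deviatingMaps_iff [NeZero n] {f : Fin n → Fin n} {π : Equiv.Perm (Fin n)} :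
    f ∈ deviatingMaps ε π ↔ ε * n < |(deviation (π.symm ∘ f ∘ π) n : ℝ)| := by
  have hn : (0 : ℝ) < n := Nat.cast_pos.2 (NeZero.pos n)
  have heq : greedyRatio (functionalGraph f) π / (1 / 2) - 1 =
      deviation (π.symm ∘ f ∘ π) n / n := by
    rw [greedyRatio_functionalGraph, deviation_last]
    push_cast
    field_simp
  rw [deviatingMaps, Finset.mem_filter_univ, heq, abs_div, abs_of_pos hn, lt_div_iff₀ hn]

theorem card_deviatingMaps_le [NeZero n] (hε : 0 ≤ ε) (hε' : ε ≤ 2) (π : Equiv.Perm (Fin n)) :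
    ((deviatingMaps ε π).card : ℝ) ≤ n ^ n * (4 * Real.exp (1 - ε ^ 2 / 4 * n)) := by
  refine le_trans ?_ (card_lt_abs_deviation_le hε hε')
  rw [Nat.cast_le]
  refine Finset.card_le_card_of_injOn (fun f => π.symm ∘ f ∘ π) (fun f hf => ?_) fun f _ g _ h => ?_
  · simpa using mem_deviatingMaps_iff.1 hf
  · exact π.surjective.injective_comp_right (π.symm.injective.comp_left h)

end Concentration

/-! ### Counting labelled trees -/

section ForestMap

variable {V : Type*} {f : V → V} {u v x y : V}

/-- The orbits of `f` end in fixed points: `f` is the parent map of a rooted forest, in which a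
root is its own parent. -/
def IsForestMap (f : V → V) : Prop :=
  ∀ v, ∃ N, f (f^[N] v) = f^[N] v

theorem eq_of_iterate_eq_of_fixed {M N : ℕ} (hx : f x = x) (hy : f y = y) (hMx : f^[M] v = x)
    (hNy : f^[N] v = y) : x = y := by
  rw [← Function.iterate_fixed hx N, ← hMx, ← Function.iterate_add_apply, add_comm,
    Function.iterate_add_apply, hNy, Function.iterate_fixed hy]

variable [DecidableEq V]

theorem iterate_update_of_fixed_ne (hx : f x = x) {N : ℕ} (hN : f^[N] v ≠ x) :
    (Function.update f x y)^[N] v = f^[N] v := by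
  induction N generalizing v with
  | zero => rfl
  | succ N ih =>
    have hv : v ≠ x := by
      rintro rfl
      exact hN (Function.iterate_fixed hx _)
    rw [Function.iterate_succ_apply, Function.update_of_ne hv, Function.iterate_succ_apply]
    exact ih hN

theorem exists_iterate_update_eq {N : ℕ} (hN : f^[N] v = x) :
    ∃ M, (Function.update f x y)^[M] v = x := by
  induction N generalizing v with
  | zero => exact ⟨0, hN⟩
  | succ N ih =>
    rcases eq_or_ne v x with rfl | hv
    · exact ⟨0, rfl⟩
    · obtain ⟨M, hM⟩ := ih hN
      exact ⟨M + 1, by rwa [Function.iterate_succ_apply, Function.update_of_ne hv]⟩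

theorem IsForestMap.update (hf : IsForestMap f) (hx : f x = x) (hy : ∀ N, f^[N] y ≠ x) :
    IsForestMap (Function.update f x y) := by
  have of_ne : ∀ {v N}, f (f^[N] v) = f^[N] v → f^[N] v ≠ x →
      Function.update f x y ((Function.update f x y)^[N] v) = (Function.update f x y)^[N] v := by
    intro v N hfix hne
    rw [iterate_update_of_fixed_ne hx hne, Function.update_of_ne hne, hfix]
  intro v
  obtain ⟨N, hN⟩ := hf v
  by_cases hv : f^[N] v = x
  · obtain ⟨M, hM⟩ := exists_iterate_update_eq (y := y) hv
    obtain ⟨K, hK⟩ := hf y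
    refine ⟨K + (M + 1), ?_⟩
    rw [Function.iterate_add_apply, Function.iterate_succ_apply', hM, Function.update_self]
    exact of_ne hK (hy K)
  · exact ⟨N, of_ne hN hv⟩

variable [Fintype V]

open Classical in
/-- The parent maps of rooted forests on `V` with `k` edges. -/
noncomputable def forestMaps (V : Type*) [Fintype V] [DecidableEq V] (k : ℕ) : Finset (V → V) :=
  {f | IsForestMap f ∧ Finset.card {v | f v ≠ v} = k}

theorem mem_forestMaps {k : ℕ} :
    f ∈ forestMaps V k ↔ IsForestMap f ∧ Finset.card {v | f v ≠ v} = k := by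
  simp only [forestMaps, Finset.mem_filter_univ]

theorem card_fixed_of_mem_forestMaps {k : ℕ} (hf : f ∈ forestMaps V k) :
    Finset.card {v | f v = v} = Fintype.card V - k := by
  have := Finset.card_filter_add_card_filter_not (s := Finset.univ) fun v => f v = v
  have := (mem_forestMaps.1 hf).2
  rw [← Finset.card_univ]
  grind

theorem update_mem_forestMaps {k : ℕ} (hf : f ∈ forestMaps V k) (hx : f x = x)
    (hy : ∀ N, f^[N] y ≠ x) : Function.update f x y ∈ forestMaps V (k + 1) := by
  rw [mem_forestMaps] at hf ⊢
  refine ⟨hf.1.update hx hy, ?_⟩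
  have : ({v | Function.update f x y v ≠ v} : Finset V) =
      insert x ({v | f v ≠ v} : Finset V) := by
    ext v
    rcases eq_or_ne v x with rfl | hv
    · simpa using hy 0
    · simp [hv]
  rw [this, Finset.card_insert_of_notMem (by simpa using hx), hf.2]

open Classical in
/-- The pairs `(x, y)` for which the root `x` of the forest with parent map `f` can be attached as
a child of `y`. -/
noncomputable def attachments (f : V → V) : Finset (V × V) :=
  {p | f p.1 = p.1 ∧ ∀ N, f^[N] p.2 ≠ p.1}

theorem mem_attachments {p : V × V} :
    p ∈ attachments f ↔ f p.1 = p.1 ∧ ∀ N, f^[N] p.2 ≠ p.1 := by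
  simp only [attachments, Finset.mem_filter_univ]

theorem card_attachments {k : ℕ} (hf : f ∈ forestMaps V k) :
    (attachments f).card = Fintype.card V * (Fintype.card V - (k + 1)) := by
  choose N hN using (mem_forestMaps.1 hf).1
  have hfiber : ∀ y, Finset.card {p ∈ attachments f | p.2 = y} =
      Fintype.card V - (k + 1) := by
    intro y
    have : {p ∈ attachments f | p.2 = y} =
        (({x | f x = x} : Finset V).erase (f^[N y] y)).image fun x => (x, y) := by
      ext ⟨x, y'⟩
      simp only [Finset.mem_filter, mem_attachments, Finset.mem_image, Finset.mem_erase,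
        Finset.mem_univ, true_and, Prod.mk.injEq]
      constructor
      · rintro ⟨⟨hx, hy⟩, rfl⟩
        exact ⟨x, ⟨(hy _).symm, hx⟩, rfl, rfl⟩
      · rintro ⟨x, ⟨hne, hx⟩, rfl, rfl⟩
        exact ⟨⟨hx, fun M hM => hne (eq_of_iterate_eq_of_fixed hx (hN y) hM rfl)⟩, rfl⟩
    rw [this, Finset.card_image_of_injective _ fun _ _ h => (Prod.mk.inj h).1,
      Finset.card_erase_of_mem (by simpa using hN y), card_fixed_of_mem_forestMaps hf,
      Nat.sub_sub]
  rw [Finset.card_eq_sum_card_fiberwise (f := Prod.snd) (t := Finset.univ) (by simp),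
    Finset.sum_congr rfl fun y _ => hfiber y, Finset.sum_const, Finset.card_univ, smul_eq_mul]

theorem update_injOn_attachments :
    Set.InjOn (fun p : V × V => Function.update f p.1 p.2) (attachments f) := by
  rintro ⟨x, y⟩ hp ⟨x', y'⟩ hp' heq
  obtain ⟨hx, hy⟩ := mem_attachments.1 hp
  have heq : Function.update f x y = Function.update f x' y' := heq
  have hxx' : x = x' := by
    by_contra hne
    have := congrFun heq x
    rw [Function.update_self, Function.update_of_ne hne, hx] at this
    exact hy 0 this
  subst hxx'
  rw [Prod.mk.injEq, Function.update_injective f x heq]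
  exact ⟨rfl, rfl⟩

theorem card_forestMaps_mul_le (V : Type*) [Fintype V] [DecidableEq V] (k : ℕ) :
    (forestMaps V k).card * (Fintype.card V * (Fintype.card V - (k + 1))) ≤
      (forestMaps V (k + 1)).card * (k + 1) := by
  classical
  let Extends (f g : V → V) : Prop := ∃ x, g x ≠ x ∧ f = Function.update g x x
  refine Finset.card_mul_le_card_mul Extends (fun f hf => ?_) fun g hg => ?_
  · rw [← card_attachments hf, ← Finset.card_image_of_injOn update_injOn_attachments]
    refine Finset.card_le_card fun g hg => ?_
    obtain ⟨⟨x, y⟩, hp, rfl⟩ := Finset.mem_image.1 hg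
    obtain ⟨hx, hy⟩ := mem_attachments.1 hp
    refine Finset.mem_filter.2 ⟨update_mem_forestMaps hf hx hy, x, ?_, ?_⟩
    · simpa using hy 0
    · rw [Function.update_idem, Function.update_eq_self_iff.2 hx.symm]
  · rw [← (mem_forestMaps.1 hg).2]
    refine (Finset.card_le_card fun f hf => ?_).trans
      (Finset.card_image_le (f := fun x => Function.update g x x))
    obtain ⟨-, x, hx, rfl⟩ := Finset.mem_filter.1 hf
    exact Finset.mem_image.2 ⟨x, by simpa using hx, rfl⟩

theorem pow_mul_descFactorial_le_card_forestMaps (V : Type*) [Fintype V] [DecidableEq V] (k : ℕ) :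
    Fintype.card V ^ k * (Fintype.card V - 1).descFactorial k ≤
      (forestMaps V k).card * k.factorial := by
  set n := Fintype.card V
  induction k with
  | zero =>
    have : id ∈ forestMaps V 0 := mem_forestMaps.2 ⟨fun v => ⟨0, rfl⟩, by simp⟩
    simpa using Finset.card_pos.2 ⟨_, this⟩
  | succ k ih =>
    calc n ^ (k + 1) * (n - 1).descFactorial (k + 1)
        = (n ^ k * (n - 1).descFactorial k) * (n * (n - (k + 1))) := by
          rw [Nat.descFactorial_succ, Nat.sub_sub, add_comm 1 k]
          ring
      _ ≤ (forestMaps V k).card * k.factorial * (n * (n - (k + 1))) := by gcongr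
      _ = (forestMaps V k).card * (n * (n - (k + 1))) * k.factorial := by ring
      _ ≤ (forestMaps V (k + 1)).card * (k + 1) * k.factorial :=
          Nat.mul_le_mul_right _ (card_forestMaps_mul_le V k)
      _ = (forestMaps V (k + 1)).card * (k + 1).factorial := by
          rw [Nat.factorial_succ, mul_assoc]

theorem pow_le_card_forestMaps (V : Type*) [Fintype V] [DecidableEq V] :
    Fintype.card V ^ (Fintype.card V - 1) ≤ (forestMaps V (Fintype.card V - 1)).card := by
  have h := pow_mul_descFactorial_le_card_forestMaps V (Fintype.card V - 1)
  rw [Nat.descFactorial_self] at h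
  exact Nat.le_of_mul_le_mul_right h (Nat.factorial_pos _)

/-- `f` is the parent map of a tree rooted at `r`, where `r` is its own parent. -/
def IsParentMap (f : V → V) (r : V) : Prop :=
  f r = r ∧ ∀ v, ∃ N, f^[N] v = r

theorem exists_isParentMap_of_mem_forestMaps [Nonempty V]
    (hf : f ∈ forestMaps V (Fintype.card V - 1)) : ∃ r, IsParentMap f r := by
  have hcard := card_fixed_of_mem_forestMaps hf
  rw [Nat.sub_sub_self Fintype.card_pos] at hcard
  obtain ⟨r, hr⟩ := Finset.card_eq_one.1 hcard
  have hfixed : ∀ v, f v = v ↔ v = r := fun v => by simpa using Finset.ext_iff.1 hr v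
  refine ⟨r, (hfixed r).2 rfl, fun v => ?_⟩
  obtain ⟨N, hN⟩ := (mem_forestMaps.1 hf).1 v
  exact ⟨N, (hfixed _).1 hN⟩

end ForestMap

section ParentMap

variable {n : ℕ} {f g : Fin n → Fin n} {r : Fin n}

theorem functionalGraph_reachable_iterate (f : Fin n → Fin n) (v : Fin n) (N : ℕ) :
    (functionalGraph f).Reachable v (f^[N] v) := by
  induction N with
  | zero => exact .rfl
  | succ N ih =>
    rw [Function.iterate_succ_apply']
    rcases eq_or_ne (f^[N] v) (f (f^[N] v)) with heq | hne
    · rwa [← heq]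
    · exact ih.trans (functionalGraph_adj.2 ⟨hne, .inl rfl⟩ : (functionalGraph f).Adj _ _).reachable

theorem IsParentMap.connected (hf : IsParentMap f r) : (functionalGraph f).Connected := by
  refine (SimpleGraph.connected_iff_exists_forall_reachable _).2 ⟨r, fun v => ?_⟩
  obtain ⟨N, hN⟩ := hf.2 v
  exact (hN ▸ functionalGraph_reachable_iterate f v N).symm

theorem functionalGraph_edgeSet_subset (hr : f r = r) :
    (functionalGraph f).edgeSet ⊆ (Finset.univ.erase r).image fun v => s(v, f v) := by
  intro e he
  induction e with | _ u v
  have hne_r : ∀ {w}, w ≠ f w → w ∈ Finset.univ.erase r := fun hw =>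
    Finset.mem_erase.2 ⟨fun h => hw (h ▸ hr.symm), Finset.mem_univ _⟩
  have hadj : (functionalGraph f).Adj u v := he
  obtain ⟨hne, rfl | rfl⟩ := functionalGraph_adj.1 hadj
  · exact Finset.mem_image.2 ⟨u, hne_r hne, rfl⟩
  · exact Finset.mem_image.2 ⟨v, hne_r hne.symm, Sym2.eq_swap⟩

theorem IsParentMap.isTree (hf : IsParentMap f r) : (functionalGraph f).IsTree := by
  refine SimpleGraph.isTree_iff_connected_and_card.2 ⟨hf.connected, le_antisymm ?_
    hf.connected.card_vert_le_card_edgeSet_add_one⟩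
  have hedges := Set.ncard_le_ncard (functionalGraph_edgeSet_subset hf.1)
    (Finset.finite_toSet _)
  rw [Set.ncard_coe_finset] at hedges
  have hcard := hedges.trans Finset.card_image_le
  rw [Nat.card_coe_set_eq]
  calc _ ≤ (Finset.univ.erase r).card + 1 := by gcongr
    _ = Nat.card (Fin n) := by
      rw [Finset.card_erase_add_one (Finset.mem_univ r), Finset.card_univ,
        Nat.card_eq_fintype_card]

theorem IsParentMap.eq_of_functionalGraph_eq (hf : IsParentMap f r) (hg : g r = r)
    (hfg : functionalGraph f = functionalGraph g) : f = g := by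
  have heq : ∀ N v, f^[N] v = r → f v = g v := by
    intro N
    induction N with
    | zero => rintro v rfl; exact hf.1.trans hg.symm
    | succ N ih =>
      intro v hv
      have ih' : f (f v) = g (f v) := ih (f v) hv
      by_cases hfv : v = f v
      · rw [← hfv] at ih'
        exact hfv ▸ ih'
      have hadj : (functionalGraph g).Adj v (f v) := hfg ▸ functionalGraph_adj.2 ⟨hfv, .inl rfl⟩
      refine ((functionalGraph_adj.1 hadj).2.resolve_right fun hgfv => hfv ?_).symm
      have hperiodic : f^[2] v = v := ih'.trans hgfv
      have hvr : v = r :=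
        calc v = (f^[2])^[N + 1] v := (Function.iterate_fixed hperiodic _).symm
          _ = (f^[N + 1])^[2] v := by rw [← Function.iterate_mul, mul_comm, Function.iterate_mul]
          _ = f^[N + 1] r := congrArg f^[N + 1] hv
          _ = r := Function.iterate_fixed hf.1 _
      exact hvr ▸ hf.1.symm
  exact funext fun v => (hf.2 v).elim fun N hN => heq N v hN

theorem functionalGraph_le {G : SimpleGraph (Fin n)} (h : ∀ v, f v = v ∨ G.Adj v (f v)) :
    functionalGraph f ≤ G := by
  intro u v huv
  obtain ⟨hne, rfl | rfl⟩ := functionalGraph_adj.1 huv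
  · exact (h u).resolve_left hne.symm
  · exact ((h v).resolve_left hne).symm

theorem exists_isParentMap_adj {G : SimpleGraph (Fin n)} (hG : G.Connected) (r : Fin n) :
    ∃ f, IsParentMap f r ∧ ∀ v, f v = v ∨ G.Adj v (f v) := by
  have hcloser : ∀ v, ∃ w, v = r ∧ w = r ∨ G.Adj v w ∧ G.dist w r < G.dist v r := by
    intro v
    obtain ⟨p, hp⟩ := hG.exists_walk_length_eq_dist v r
    cases p with
    | nil => exact ⟨r, .inl ⟨rfl, rfl⟩⟩
    | cons hadj q => exact ⟨_, .inr ⟨hadj, hp ▸ Nat.lt_succ_of_le (SimpleGraph.dist_le q)⟩⟩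
  choose f hf using hcloser
  refine ⟨f, ⟨?_, fun v => ?_⟩, fun v => ?_⟩
  · rcases hf r with h | h
    · exact h.2
    · simp at h
  · induction v using (measure (G.dist · r)).wf.induction with | _ v ih
    rcases hf v with h | h
    · exact ⟨0, h.1⟩
    · obtain ⟨N, hN⟩ := ih (f v) h.2
      exact ⟨N + 1, hN⟩
  · rcases hf v with h | h
    · exact .inl (h.2.trans h.1.symm)
    · exact .inr h.1

theorem exists_functionalGraph_eq {G : SimpleGraph (Fin n)} (hG : G.IsTree) :
    ∃ f, functionalGraph f = G := by
  obtain ⟨r⟩ := hG.connected.nonempty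
  obtain ⟨f, hf, hadj⟩ := exists_isParentMap_adj hG.connected r
  have hle := functionalGraph_le hadj
  exact ⟨f, hle.antisymm ((SimpleGraph.isTree_iff_minimal_connected.1 hG).2 hf.connected hle)⟩

/-- The labelled trees on `n` vertices, as the support of `uniformTree n`. -/
noncomputable def labelledTrees (n : ℕ) : Finset (SimpleGraph (Fin n)) :=
  (Set.toFinite {G : SimpleGraph (Fin n) | G.IsTree}).toFinset

theorem mem_labelledTrees {G : SimpleGraph (Fin n)} : G ∈ labelledTrees n ↔ G.IsTree :=
  Set.Finite.mem_toFinset _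

theorem card_forestMaps_le (n : ℕ) [NeZero n] :
    (forestMaps (Fin n) (n - 1)).card ≤ (labelledTrees n).card * n := by
  have hroot : ∀ f ∈ forestMaps (Fin n) (n - 1), ∃ r, IsParentMap f r := fun f hf =>
    exists_isParentMap_of_mem_forestMaps (by rwa [Fintype.card_fin])
  choose! root hroot using hroot
  calc (forestMaps (Fin n) (n - 1)).card
      ≤ (labelledTrees n ×ˢ (Finset.univ : Finset (Fin n))).card := by
        refine Finset.card_le_card_of_injOn (fun f => (functionalGraph f, root f)) (fun f hf => ?_)
          fun f hf g hg heq => ?_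
        · simpa using mem_labelledTrees.2 (hroot f hf).isTree
        · obtain ⟨hgraph, hr⟩ := Prod.mk.inj heq
          exact (hroot f hf).eq_of_functionalGraph_eq (hr ▸ (hroot g hg).1) hgraph
    _ = (labelledTrees n).card * n := by rw [Finset.card_product, Finset.card_fin]

theorem pow_le_card_labelledTrees_mul (n : ℕ) [NeZero n] :
    n ^ n ≤ (labelledTrees n).card * n ^ 2 := by
  have hforest := pow_le_card_forestMaps (Fin n)
  rw [Fintype.card_fin] at hforest
  calc n ^ n = n ^ (n - 1) * n := by rw [← pow_succ, Nat.sub_add_cancel (NeZero.one_le)]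
    _ ≤ (labelledTrees n).card * n * n := by
        gcongr
        exact hforest.trans (card_forestMaps_le n)
    _ = (labelledTrees n).card * n ^ 2 := by rw [mul_assoc, sq]

end ParentMap

/-! ### Asymptotics with high probability -/

section Whp

variable {n : ℕ} {ε : ℝ}

theorem measurableSet_lt_abs_div_sub_one (c ε : ℝ) : MeasurableSet {x : ℝ | ε < |x / c - 1|} :=
  measurableSet_lt measurable_const (by fun_prop)

theorem asympWhp_of_tendsto_zero {L : ℕ → PMF ℝ} {c δ : ℝ} (hδ : 0 < δ)
    (h : ∀ ε, 0 < ε → ε ≤ δ →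
      Tendsto (fun n => (L n).toMeasure {x : ℝ | ε < |x / c - 1|}) atTop (𝓝 0)) :
    AsympWhp L c := by
  intro ε hε
  have hmin := h (min ε δ) (lt_min hε hδ) (min_le_right _ _)
  have hbad : Tendsto (fun n => (L n).toMeasure {x : ℝ | ε < |x / c - 1|}) atTop (𝓝 0) :=
    tendsto_of_tendsto_of_tendsto_of_le_of_le tendsto_const_nhds hmin (fun _ => zero_le)
      fun n => measure_mono fun x hx => (min_le_left ε δ).trans_lt hx
  have hgood := ENNReal.Tendsto.sub tendsto_const_nhds hbad (.inl ENNReal.one_ne_top)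
  rw [tsub_zero] at hgood
  refine hgood.congr fun n => ?_
  rw [← prob_compl_eq_one_sub (measurableSet_lt_abs_div_sub_one c ε)]
  simp only [Set.compl_ofPred, not_lt]

theorem greedyRatioLaw_toMeasure_le (p : PMF (SimpleGraph (Fin n))) {B : Set ℝ}
    (hB : MeasurableSet B) {c : ℝ≥0∞}
    (h : ∀ π, (p.map (greedyRatio · π)).toMeasure B ≤ c) :
    (greedyRatioLaw p).toMeasure B ≤ c := by
  have hcomm : greedyRatioLaw p = (PMF.uniformOfFintype (Equiv.Perm (Fin n))).bind
      fun π => p.map (greedyRatio · π) := PMF.bind_comm _ _ _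
  rw [hcomm, PMF.toMeasure_bind_apply _ _ _ hB]
  calc _ ≤ ∑' π, PMF.uniformOfFintype (Equiv.Perm (Fin n)) π * c := by
        gcongr with π
        exact h π
    _ = c := by rw [ENNReal.tsum_mul_right, PMF.tsum_coe, one_mul]

theorem toMeasure_map_uniformOfFinset_le {α β : Type*} [MeasurableSpace β] {s t : Finset α}
    (hs : s.Nonempty) (g : α → β) {B : Set β} (hB : MeasurableSet B)
    (hst : ∀ a ∈ s, g a ∈ B → a ∈ t) {r : ℝ} (hr : (t.card : ℝ) ≤ s.card * r) :
    ((PMF.uniformOfFinset s hs).map g).toMeasure B ≤ ENNReal.ofReal r := by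
  classical
  rw [PMF.toMeasure_apply_eq_toOuterMeasure_apply _ hB, PMF.toOuterMeasure_map_apply,
    PMF.toOuterMeasure_uniformOfFinset_apply]
  refine ENNReal.div_le_of_le_mul' ?_
  rw [← ENNReal.ofReal_natCast, ← ENNReal.ofReal_natCast, ← ENNReal.ofReal_mul (by positivity)]
  refine ENNReal.ofReal_le_ofReal (le_trans ?_ hr)
  gcongr
  exact fun a ha => hst a (Finset.mem_filter.1 ha).1 (Finset.mem_filter.1 ha).2

theorem greedyRatioLaw_randomFunctionalGraph_le [NeZero n] (hε : 0 ≤ ε) (hε' : ε ≤ 2) :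
    (greedyRatioLaw (randomFunctionalGraph n)).toMeasure {x : ℝ | ε < |x / (1 / 2) - 1|} ≤
      ENNReal.ofReal (4 * Real.exp (1 - ε ^ 2 / 4 * n)) := by
  have hB := measurableSet_lt_abs_div_sub_one (1 / 2) ε
  refine greedyRatioLaw_toMeasure_le _ hB fun π => ?_
  rw [randomFunctionalGraph, PMF.map_comp, PMF.uniformOfFintype]
  refine toMeasure_map_uniformOfFinset_le _ _ hB (t := deviatingMaps ε π) (fun f _ hf => ?_) ?_
  · exact Finset.mem_filter_univ f |>.2 hf
  · rw [Finset.card_univ, Fintype.card_fun, Fintype.card_fin, Nat.cast_pow]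
    exact card_deviatingMaps_le hε hε' π

theorem greedyRatioLaw_uniformTree_le [NeZero n] (hε : 0 ≤ ε) (hε' : ε ≤ 2) :
    (greedyRatioLaw (uniformTree n)).toMeasure {x : ℝ | ε < |x / (1 / 2) - 1|} ≤
      ENNReal.ofReal (n ^ 2 * (4 * Real.exp (1 - ε ^ 2 / 4 * n))) := by
  classical
  have hB := measurableSet_lt_abs_div_sub_one (1 / 2) ε
  refine greedyRatioLaw_toMeasure_le _ hB fun π => ?_
  refine toMeasure_map_uniformOfFinset_le _ _ hB (t := (deviatingMaps ε π).image functionalGraph)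
    (fun G hG hdev => ?_) ?_
  · obtain ⟨f, rfl⟩ := exists_functionalGraph_eq (mem_labelledTrees.1 hG)
    exact Finset.mem_image_of_mem _ (Finset.mem_filter_univ f |>.2 hdev)
  · have hcard : (n : ℝ) ^ n ≤ (labelledTrees n).card * (n : ℝ) ^ 2 := by
      exact_mod_cast pow_le_card_labelledTrees_mul n
    calc (((deviatingMaps ε π).image functionalGraph).card : ℝ)
        ≤ (deviatingMaps ε π).card := Nat.cast_le.2 Finset.card_image_le
      _ ≤ n ^ n * (4 * Real.exp (1 - ε ^ 2 / 4 * n)) := card_deviatingMaps_le hε hε' π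
      _ ≤ (labelledTrees n).card * n ^ 2 * (4 * Real.exp (1 - ε ^ 2 / 4 * n)) := by gcongr
      _ = _ := mul_assoc _ _ _

theorem tendsto_sq_mul_exp_neg_mul {b : ℝ} (hb : 0 < b) :
    Tendsto (fun n : ℕ => (n : ℝ) ^ 2 * (4 * Real.exp (1 - b * n))) atTop (𝓝 0) := by
  have h := ((tendsto_rpow_mul_exp_neg_mul_atTop_nhds_zero 2 b hb).comp
    tendsto_natCast_atTop_atTop).const_mul (4 * Real.exp 1)
  rw [mul_zero] at h
  refine h.congr fun n => ?_
  simp only [Function.comp_apply, Real.rpow_two]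
  rw [sub_eq_add_neg, Real.exp_add, ← neg_mul]
  ring

theorem asympWhp_half_of_toMeasure_le {L : ℕ → PMF ℝ}
    (h : ∀ n ε, 0 ≤ ε → ε ≤ 2 → (L n).toMeasure {x : ℝ | ε < |x / (1 / 2) - 1|} ≤
      ENNReal.ofReal ((n + 1 : ℕ) ^ 2 * (4 * Real.exp (1 - ε ^ 2 / 4 * (n + 1 : ℕ))))) :
    AsympWhp L (1 / 2) := by
  refine asympWhp_of_tendsto_zero two_pos fun ε hε hε' => ?_
  have hbound := ENNReal.tendsto_ofReal ((tendsto_sq_mul_exp_neg_mul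
    (b := ε ^ 2 / 4) (by positivity)).comp (tendsto_add_atTop_nat 1))
  rw [ENNReal.ofReal_zero] at hbound
  exact tendsto_of_tendsto_of_tendsto_of_le_of_le tendsto_const_nhds hbound (fun _ => zero_le)
    fun n => h n ε hε.le hε'

theorem asympWhp_uniformTree :
    AsympWhp (fun n => greedyRatioLaw (uniformTree (n + 1))) (1 / 2) :=
  asympWhp_half_of_toMeasure_le fun _ _ => greedyRatioLaw_uniformTree_le

theorem asympWhp_randomFunctionalGraph :
    AsympWhp (fun n => greedyRatioLaw (randomFunctionalGraph (n + 1))) (1 / 2) := by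
  refine asympWhp_half_of_toMeasure_le fun n ε hε hε' =>
    (greedyRatioLaw_randomFunctionalGraph_le hε hε').trans (ENNReal.ofReal_le_ofReal ?_)
  exact le_mul_of_one_le_left (by positivity) (one_le_pow₀ (by exact_mod_cast n.succ_pos))

end Whp

end GreedyMIS

theorem mainTheorem6_general :
    (∀ lam : ℝ≥0, 0 < lam →
      GreedyMIS.BPNonexplosive GreedyMIS.SBType.spine (GreedyMIS.sbgwOffspring lam) ∧
      GreedyMIS.BPNonexplosive () (GreedyMIS.gwOffspring lam) ∧
      GreedyMIS.bpIota GreedyMIS.SBType.spine (GreedyMIS.sbgwOffspring lam)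
        = 1 - (1 + (lam : ℝ)) ^ (-1 / (lam : ℝ)) ∧
      GreedyMIS.bpIota GreedyMIS.SBType.spine (GreedyMIS.sbgwOffspring lam)
        = 1 - Real.exp (-GreedyMIS.bpIota () (GreedyMIS.gwOffspring lam))) ∧
    GreedyMIS.bpIota GreedyMIS.SBType.spine (GreedyMIS.sbgwOffspring 1) = 1 / 2 ∧
    GreedyMIS.AsympWhp
      (fun n => GreedyMIS.greedyRatioLaw (GreedyMIS.uniformTree (n + 1))) (1 / 2) ∧
    GreedyMIS.AsympWhp
      (fun n => GreedyMIS.greedyRatioLaw (GreedyMIS.randomFunctionalGraph (n + 1))) (1 / 2) := by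
  refine ⟨fun lam hlam => ⟨?_, ?_, ?_, ?_⟩, GreedyMIS.bpIota_sbgwOffspring_one,
    GreedyMIS.asympWhp_uniformTree, GreedyMIS.asympWhp_randomFunctionalGraph⟩
  · exact GreedyMIS.bpNonexplosive_of_integrable
      (GreedyMIS.integrable_natCast_sbgwOffspring lam) .spine
  · exact GreedyMIS.bpNonexplosive_of_integrable
      (GreedyMIS.integrable_natCast_gwOffspring lam) ()
  · exact GreedyMIS.bpIota_sbgwOffspring_eq_rpow hlam
  · rw [GreedyMIS.bpIota_sbgwOffspring hlam, GreedyMIS.bpIota_gwOffspring hlam]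

theorem mainTheorem6 :
    (∀ lam : ℝ≥0, 0 < lam → lam ≤ 1 →
      GreedyMIS.BPNonexplosive GreedyMIS.SBType.spine (GreedyMIS.sbgwOffspring lam) ∧
      GreedyMIS.BPNonexplosive () (GreedyMIS.gwOffspring lam) ∧
      GreedyMIS.bpIota GreedyMIS.SBType.spine (GreedyMIS.sbgwOffspring lam)
        = 1 - (1 + (lam : ℝ)) ^ (-1 / (lam : ℝ)) ∧
      GreedyMIS.bpIota GreedyMIS.SBType.spine (GreedyMIS.sbgwOffspring lam)
        = 1 - Real.exp (-GreedyMIS.bpIota () (GreedyMIS.gwOffspring lam))) ∧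
    GreedyMIS.bpIota GreedyMIS.SBType.spine (GreedyMIS.sbgwOffspring 1) = 1 / 2 ∧
    GreedyMIS.AsympWhp
      (fun n => GreedyMIS.greedyRatioLaw (GreedyMIS.uniformTree (n + 1))) (1 / 2) ∧
    GreedyMIS.AsympWhp
      (fun n => GreedyMIS.greedyRatioLaw (GreedyMIS.randomFunctionalGraph (n + 1))) (1 / 2) :=
  ⟨fun lam hlam _ => mainTheorem6_general.1 lam hlam, mainTheorem6_general.2⟩
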